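/- **Setting.** Let $F:\mathbb R^p\to\mathbb R^p$ be single-valued, $T:\mathbb R^p\rightrightarrows\mathbb R^p$ multivalued, $\Phi:=F+T$, and $\operatorname{zer}(\Phi)=\{x: 0\in\Phi x\}\neq\emptyset$. One of two settings holds. (F) Finite sum: $F=\frac1n\sum_{i=1}^nF_i$ with $n\ge1$; put $\mathcal E(x,y):=\frac1n\sum_{i=1}^n\|F_ix-F_iy\|^2$. (E) Expectation: $Fx=\mathbb E_\xi[\mathbf F(x,\xi)]$ and, for some $\sigma\ge0$, $\mathbb E_\xi\|\mathbf F(x,\xi)-Fx\|^2\le\sigma^2$ for all $x$; put $\mathcal E(x,y):=\mathbb E_\xi\|\mathbf F(x,\xi)-\mathbf F(y,\xi)\|^2$. In both settings there is $L>0$ with $\langle Fx-Fy,x-y\rangle\ge\frac1L\mathcal E(x,y)$ for all $x,y$. For some $\rho\ge0$ with $L\rho<1$, $T$ is maximally $\rho$-co-hypomonotone: $\langle u-v,x-y\rangle\ge-\rho\|u-v\|^2$ for all $u\in Tx$, $v\in Ty$, and the graph of $T$ is not properly contained in the graph of another operator with this property. Write $J_{\lambda T}u:=\{x: u\in x+\lambda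 Tx\}$ for the resolvent (which is single-valued for the $\lambda$ below) and $S_\lambda u:=F(J_{\lambda T}u)+\frac1\lambda(u-J_{\lambda T}u)$. **Parameters.** Let $\hat L>L$ with $\hat L\rho<1$, $\Lambda:=\frac{\hat L-L}{L\hat L}$, $\lambda>0$ with $2\rho\le\lambda<\frac{2(1+\sqrt{1-\hat L\rho})}{\hat L}$, $\bar\beta:=\frac{\lambda(4-\hat L\lambda)-4\rho}{4(1-\rho\hat L)}$, $0<\mu<\frac23$, $r\ge2+\frac1\mu$, $\nu:=\frac\mu2$, $0<\beta<\frac{(2-\mu)\bar\beta}{2+\mu}$, $t_k:=\mu(k+r)$ and $\eta_k:=\frac{2\beta(t_k-1)}{t_k-\nu}$. **Algorithm (VFOSA$_-$).** On a probability space with a filtration $(\mathcal F_k)_{k\ge0}$, write $\mathbb E_k:=\mathbb E[\,\cdot\mid\mathcal F_k]$. Let $u^0:=x^0+\lambda\xi^0$ with $\xi^0\in Tx^0$ be $\mathcal F_0$-measurable (for instance deterministic), $s^0:=u^0$, and for $k\ge0$ $$x^k:=J_{\lambda T}u^k,\quad v^k:=\tfrac{t_k-1}{t_k}u^k+\tfrac1{t_k}s^k,\quad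 u^{k+1}:=v^k-\eta_k\big(\widetilde F^k+\tfrac1\lambda(u^k-x^k)\big),\quad s^{k+1}:=s^k+\nu(u^{k+1}-v^k).$$ Set $\xi^k:=\frac1\lambda(u^k-x^k)$, so that $\xi^k\in Tx^k$. The estimators $\widetilde F^k$ have the following variance-reduction property: $x^k$ is $\mathcal F_k$-measurable, $\widetilde F^k$ is $\mathcal F_{k+1}$-measurable, and there are $\kappa_k\in(0,1]$, $\Theta_k\ge0$, $\sigma_k\ge0$ and $\mathcal F_{k+1}$-measurable random variables $\Delta_k\ge0$ such that, almost surely for all $k\ge0$, with $x^{-1}:=x^0$ and $\Delta_{-1}:=0$, $$\mathbb E_k\|\widetilde F^k-Fx^k\|^2\le\mathbb E_k[\Delta_k],\qquad \mathbb E_k[\Delta_k]\le(1-\kappa_k)\Delta_{k-1}+\Theta_k\,\mathcal E(x^k,x^{k-1})+\sigma_k^2 .$$ Assume that there are reals $\Gamma_k$ and constants $\underline\Gamma,\underline\Theta>0$ with $\Gamma_k\ge\underline\Gamma$, $\Theta_k\ge\underline\Theta$, $\Gamma_k\Theta_k\le\Lambda$ for all $k\ge0$, $$\kappa_k\ge1-\frac{\Gamma_{k-1}t_{k-2}(t_{k-2}-1)}{\Gamma_kt_{k-1}(t_{k-1}-1)}+\frac{5\beta}{\mu\Gamma_k}\quad(k\ge1),\qquad\text{and}\qquad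 \frac\Lambda\beta\sum_{k=0}^\infty t_{k-1}(t_{k-1}-1)\frac{\sigma_k^2}{\Theta_k}<\infty .$$ **Theorem.** Almost surely, $$\sum_{k\ge0}(k+1)\|Fx^k+\xi^k\|^2<\infty,\quad \sum_{k\ge0}(k+1)^2\|\widetilde F^k-Fx^k\|^2<\infty,\quad \sum_{k\ge0}(k+1)\|u^{k+1}-u^k\|^2<\infty,\quad \sum_{k\ge0}(k+1)\|x^{k+1}-x^k\|^2<\infty,$$ and almost surely $$\lim_{k\to\infty}k^2\|x^{k+1}-x^k\|^2=0,\qquad \lim_{k\to\infty}k^2\|Fx^k+\xi^k\|^2=0 .$$ Moreover, $(u^k)$ converges almost surely to a $\operatorname{zer}(S_\lambda)$-valued random variable $u^\star$, where $\operatorname{zer}(S_\lambda)=\{u: S_\lambda u=0\}$; consequently $(x^k)$ converges almost surely to the random variable $x^\star:=J_{\lambda T}u^\star$, whose values lie in $\operatorname{zer}(\Phi)$. -/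

import Mathlib

open MeasureTheory ProbabilityTheory Filter Topology
open scoped RealInnerProductSpace ENNReal

universe w

/-- The Euclidean space `ℝ^p`. -/
abbrev Vec (p : ℕ) : Type := EuclideanSpace ℝ (Fin p)

section Operators

variable {p : ℕ}

/-- A multivalued operator `T` (given by its values `T x`) is `ρ`-co-hypomonotone. -/
def CoHypomonotone (ρ : ℝ) (T : Vec p → Set (Vec p)) : Prop :=
  ∀ x y u v : Vec p, u ∈ T x → v ∈ T y → -ρ * ‖u - v‖ ^ 2 ≤ ⟪u - v, x - y⟫

/-- `T` is `ρ`-co-hypomonotone and its graph is not properly contained in the graph of another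
`ρ`-co-hypomonotone operator. -/
def MaximallyCoHypomonotone (ρ : ℝ) (T : Vec p → Set (Vec p)) : Prop :=
  CoHypomonotone ρ T ∧
    ∀ T' : Vec p → Set (Vec p), CoHypomonotone ρ T' → (∀ x, T x ⊆ T' x) → T' = T

/-- The zeros `{x | 0 ∈ A x}` of a multivalued operator. -/
def zer (A : Vec p → Set (Vec p)) : Set (Vec p) := {x | (0 : Vec p) ∈ A x}

/-- The operator `Φ = F + T`, with `F` single-valued. -/
def sumOp (F : Vec p → Vec p) (T : Vec p → Set (Vec p)) : Vec p → Set (Vec p) :=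
  fun x => {w | ∃ v ∈ T x, w = F x + v}

/-- The resolvent `J_{λT} u = {x | u ∈ x + λ T x}` as a multivalued operator. -/
def resolventOp (lam : ℝ) (T : Vec p → Set (Vec p)) : Vec p → Set (Vec p) :=
  fun u => {x | ∃ v ∈ T x, u = x + lam • v}

/-- The backward-forward splitting residual `S_λ u = F (J_{λT} u) + (u - J_{λT} u) / λ`, as a
multivalued operator; it has at most one value at each `u` at which `J_{λT}` has at most one. -/
def bfsResidual (F : Vec p → Vec p) (T : Vec p → Set (Vec p)) (lam : ℝ) :
    Vec p → Set (Vec p) :=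
  fun u => {w | ∃ x ∈ resolventOp lam T u, w = F x + lam⁻¹ • (u - x)}

end Operators

/-- The two ways in which `F` is accessed: through the summands of a finite sum, or through a
stochastic oracle `(x, ξ) ↦ bF x ξ`, where `ξ` has law `P`. -/
inductive Oracle (p : ℕ) : Type (w + 1)
  | finiteSum (n : ℕ) (Fi : Fin n → Vec p → Vec p) : Oracle p
  | expectation (Ξ : Type w) (mΞ : MeasurableSpace Ξ) (P : Measure Ξ)
      (bF : Vec p → Ξ → Vec p) : Oracle p

namespace Oracle

variable {p : ℕ}

/-- `F` is the mean of the oracle: `F x = (1/n) ∑ i, F_i x` with `n ≥ 1`, respectively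
`F x = E_ξ[bF(x, ξ)]`. -/
def Represents : Oracle.{w} p → (Vec p → Vec p) → Prop
  | finiteSum n Fi, F => 0 < n ∧ ∀ x, F x = (1 / (n : ℝ)) • ∑ i, Fi i x
  | expectation _ _ P bF, F =>
      IsProbabilityMeasure P ∧ ∀ x, Integrable (bF x) P ∧ F x = ∫ ξ, bF x ξ ∂P

/-- Bounded variance `E_ξ[‖bF(x, ξ) - F x‖²] ≤ σ²`, required in the expectation setting only. -/
def BoundedVariance : Oracle.{w} p → (Vec p → Vec p) → Prop
  | finiteSum _ _, _ => True
  | expectation _ _ P bF, F => ∃ σ : ℝ, 0 ≤ σ ∧ ∀ x,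
      Integrable (fun ξ => ‖bF x ξ - F x‖ ^ 2) P ∧ ∫ ξ, ‖bF x ξ - F x‖ ^ 2 ∂P ≤ σ ^ 2

/-- `(1/n) ∑ i, ‖F_i x - F_i y‖²`, respectively `E_ξ[‖bF(x, ξ) - bF(y, ξ)‖²]`. -/
noncomputable def meanSqDiff : Oracle.{w} p → Vec p → Vec p → ℝ
  | finiteSum n Fi, x, y => (1 / (n : ℝ)) * ∑ i, ‖Fi i x - Fi i y‖ ^ 2
  | expectation _ _ P bF, x, y => ∫ ξ, ‖bF x ξ - bF y ξ‖ ^ 2 ∂P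

/-- `F` is `1/L`-co-coercive on average, respectively in expectation. -/
def Cocoercive (O : Oracle.{w} p) (F : Vec p → Vec p) (L : ℝ) : Prop :=
  ∀ x y, (1 / L) * O.meanSqDiff x y ≤ ⟪F x - F y, x - y⟫

end Oracle

/-- `Ft k` is an estimator of `F (x k)` with the variance-reduction property
`VR(Δ_k; κ_k, Θ_k, σ_k)` for the filtration `ℱ`. The iterate `x k` is `ℱ k`-measurable, while
`Ft k` and `Δ k`, which use the sample drawn in iteration `k`, are `ℱ (k + 1)`-measurable.
The conditional expectations are those of `[0, ∞]`-valued random variables. Truncated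
subtraction encodes the convention `x^{-1} = x^0`, and `Δ_{-1} = 0`. -/
structure VREstimator {p : ℕ} {Ω : Type*} {mΩ : MeasurableSpace Ω} (Pr : Measure Ω)
    (ℱ : Filtration ℕ mΩ) (O : Oracle.{w} p) (F : Vec p → Vec p)
    (x Ft : ℕ → Ω → Vec p) (Δ : ℕ → Ω → ℝ) (κ Θ σ : ℕ → ℝ) : Prop where
  measurable_iterate : ∀ k, Measurable[ℱ k] (x k)
  measurable_estimator : ∀ k, Measurable[ℱ (k + 1)] (Ft k)
  measurable_delta : ∀ k, Measurable[ℱ (k + 1)] (Δ k)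
  delta_nonneg : ∀ k ω, 0 ≤ Δ k ω
  kappa_pos : ∀ k, 0 < κ k
  kappa_le_one : ∀ k, κ k ≤ 1
  theta_nonneg : ∀ k, 0 ≤ Θ k
  sigma_nonneg : ∀ k, 0 ≤ σ k
  error_le : ∀ k, ∀ᵐ ω ∂Pr,
    condLExp (ℱ k) Pr (fun ω' => ENNReal.ofReal (‖Ft k ω' - F (x k ω')‖ ^ 2)) ω
      ≤ condLExp (ℱ k) Pr (fun ω' => ENNReal.ofReal (Δ k ω')) ω
  delta_le : ∀ k, ∀ᵐ ω ∂Pr,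
    condLExp (ℱ k) Pr (fun ω' => ENNReal.ofReal (Δ k ω')) ω
      ≤ ENNReal.ofReal ((1 - κ k) * (if k = 0 then 0 else Δ (k - 1) ω)
          + Θ k * O.meanSqDiff (x k ω) (x (k - 1) ω) + σ k ^ 2)

/-- `t_k = μ (k + r)`, also for negative `k`. -/
def tPar (μ r : ℝ) (k : ℤ) : ℝ := μ * ((k : ℝ) + r)

/-- `η_k = 2 β (t_k - 1) / (t_k - ν)`. -/
noncomputable def etaPar (μ r ν β : ℝ) (k : ℤ) : ℝ :=
  2 * β * (tPar μ r k - 1) / (tPar μ r k - ν)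

/-- `β̄ = (λ (4 - L̂ λ) - 4 ρ) / (4 (1 - ρ L̂))`. -/
noncomputable def betaBar (lam Lhat ρ : ℝ) : ℝ :=
  (lam * (4 - Lhat * lam) - 4 * ρ) / (4 * (1 - ρ * Lhat))

/-- `Λ = (L̂ - L) / (L L̂)`. -/
noncomputable def lambdaConst (L Lhat : ℝ) : ℝ := (Lhat - L) / (L * Lhat)

/-- The random sequences generated by the variance-reduced fast backward-forward splitting
algorithm with estimators `Ft k` of `F (x k)`; here `ξ^k = (u^k - x^k) / λ`. -/
structure IsVFOSAMinus {p : ℕ} {Ω : Type*} (T : Vec p → Set (Vec p)) (lam ν : ℝ)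
    (t η : ℤ → ℝ) (x u s v ξ Ft : ℕ → Ω → Vec p) : Prop where
  init_xi : ∀ ω, ξ 0 ω ∈ T (x 0 ω)
  init_u : ∀ ω, u 0 ω = x 0 ω + lam • ξ 0 ω
  init_s : ∀ ω, s 0 ω = u 0 ω
  shadow : ∀ k ω, x k ω ∈ resolventOp lam T (u k ω)
  xi_eq : ∀ k ω, ξ k ω = lam⁻¹ • (u k ω - x k ω)
  v_eq : ∀ k ω, v k ω = ((t k - 1) / t k) • u k ω + (1 / t k) • s k ω
  u_succ : ∀ k ω, u (k + 1) ω = v k ω - η k • (Ft k ω + lam⁻¹ • (u k ω - x k ω))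
  s_succ : ∀ k ω, s (k + 1) ω = s k ω + ν • (u (k + 1) ω - v k ω)

/-! Write `G k` for the residual `F x^k + ξ^k`, `e k` for the estimator error and `w` for a zero of
`S_λ`. Seen as a function of `u`, the residual is co-coercive with constant `betaBar`, and a spare
multiple `Λ` of the oracle's mean square difference is left over (`residual_cocoercive`). The
algorithm is therefore an accelerated fixed-point scheme for `G`, run with errors `e`.

For large `t`, the function `β t (t - 1) ‖G‖² - t ⟪G, s - u⟫ + (α + γ / t) ‖s - w‖²` decreases along
the scheme up to `(4β/μ) t (t - 1) ‖e‖²`. The decrease releases a multiple of `t ‖G‖²`, together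
with `t (t - 1)` times the gap in the co-coercivity inequality (`lyap_step`).

Probability is needed only to show that `∑ t² ‖e‖²` is finite almost surely
(`VREstimator.ae_summable_error`). There the released gap dominates the term `Θ 𝓔(x^k, x^{k-1})` of
the variance recursion, and the condition on `κ` makes the weighted `Δ` decrease enough to pay for
the errors. Restriction to events on which the starting value is bounded replaces any integrability
assumption (`ae_summable_error_of_lyapunov`).

All the rest is pathwise (`AccelScheme.convergence`). The Lyapunov inequality gives `∑ t ‖G‖² < ∞`,
the momentum `s - u` tends to zero, and `‖s - w‖` converges. Hence `t² ‖G‖²` has a limit, which is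
zero because `∑ 1/t` diverges. Opial's lemma and the closed graph of `T` give convergence of `u`;
nonexpansiveness of the resolvent transfers it to `x`. -/

/-! ### One-step descent of the Lyapunov function. -/

section OneStep

variable {H : Type*} [NormedAddCommGroup H] [InnerProductSpace ℝ H]

/-- The Lyapunov function of the accelerated scheme, in terms of the residual `G`, the momentum
`z = s - u` and the distance `q = s - u⋆`. -/
noncomputable def lyap (β α γ t : ℝ) (G z q : H) : ℝ :=
  β * (t * (t - 1)) * ‖G‖ ^ 2 - t * ⟪G, z⟫ + (α + γ / t) * ‖q‖ ^ 2

/-- Two cancellations shape the scheme: the weight `t (t - 1)` on `⟪d, u₁ - u⟫` removes `⟪d, s -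
u⟫`, and the step size `η` is the one that removes `⟪d, G⟫`. -/
lemma accel_step_identity {β ν t η : ℝ} (ht : t ≠ 0) (hη : (t - ν) * η = 2 * β * (t - 1))
    {G d e u s u₁ s₁ : H} (hu : u₁ = u + t⁻¹ • (s - u) - η • (G + e))
    (hs : s₁ = s - (ν * η) • (G + e)) :
    β * (t * (t - 1)) * ‖G + d‖ ^ 2 - t * ⟪G + d, s₁ - u₁⟫ + t * (t - 1) * ⟪d, u₁ - u⟫
      = -(t - 1) * ⟪G, s - u⟫
        + β * (t * (t - 1)) * (‖d‖ ^ 2 - ‖G‖ ^ 2 - 2 * ⟪d, e⟫ - 2 * ⟪G, e⟫)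
        + t * (t - 1) * η * (‖G‖ ^ 2 + ⟪G, e⟫) := by
  have hz : s₁ - u₁ = (1 - t⁻¹) • (s - u) + ((1 - ν) * η) • (G + e) := by
    rw [hu, hs]; module
  have hd : u₁ - u = t⁻¹ • (s - u) - η • (G + e) := by rw [hu]; abel
  rw [hz, hd, norm_add_sq_real]
  simp only [inner_add_left, inner_add_right, inner_sub_right (𝕜 := ℝ) (z := η • (G + e)),
    inner_smul_right, real_inner_self_eq_norm_sq, real_inner_comm G d]
  rw [real_inner_comm d G]
  generalize ⟪G, s - u⟫ = a
  generalize ⟪d, s - u⟫ = b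
  generalize ⟪d, G⟫ = c
  generalize ⟪d, e⟫ = f
  generalize ⟪G, e⟫ = g
  generalize ‖G‖ ^ 2 = x
  generalize ‖d‖ ^ 2 = y
  have e1 : t * t⁻¹ = 1 := mul_inv_cancel₀ ht
  linear_combination (a + b * t) * e1 - t * (x + g + c + f) * hη

lemma neg_inner_le_of_sq {a b : H} {m A B : ℝ} (hA : 0 < A) (h : m ^ 2 ≤ 4 * A * B) :
    m * ⟪a, b⟫ ≤ A * ‖a‖ ^ 2 + B * ‖b‖ ^ 2 := by
  have h1 : m * ⟪a, b⟫ ≤ |m| * (‖a‖ * ‖b‖) := by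
    calc m * ⟪a, b⟫ ≤ |m * ⟪a, b⟫| := le_abs_self _
      _ = |m| * |⟪a, b⟫| := abs_mul _ _
      _ ≤ _ := by gcongr; exact abs_real_inner_le_norm a b
  have h2 : |m| ^ 2 ≤ 4 * A * B := by rwa [sq_abs]
  have h3 : 0 ≤ (4 * A * B - |m| ^ 2) * ‖b‖ ^ 2 := mul_nonneg (by linarith) (sq_nonneg _)
  nlinarith [sq_nonneg (2 * A * ‖a‖ - |m| * ‖b‖)]

/-- Everything follows from `2β - η = 2β(1 - ν)/(t - ν)`: the step size stays below its limit `2β`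
by a quantity of exact order `1/t`. -/
lemma eta_bounds {β ν t η : ℝ} (hβ : 0 < β) (hν0 : 0 < ν) (hν : ν < 1) (ht : 2 ≤ t)
    (hη : (t - ν) * η = 2 * β * (t - 1)) :
    0 < η ∧ η ≤ 2 * β ∧ 2 * β - η ≤ 4 * β / t ∧
      t * (t - 1) * (2 * β - η) ≤ 2 * β * t ∧
      2 * β * (1 - ν) * (t - 2) ≤ t * (t - 1) * (2 * β - η) := by
  have htν : 0 < t - ν := by linarith
  have e : η = 2 * β * (t - 1) / (t - ν) := by field_simp; linarith
  have e2 : 2 * β - η = 2 * β * (1 - ν) / (t - ν) := by rw [e]; field_simp; ring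
  have hp : 0 < η := by rw [e]; apply div_pos <;> nlinarith
  have hq : 0 ≤ 2 * β - η := by rw [e2]; apply div_nonneg <;> nlinarith
  refine ⟨hp, by linarith, ?_, ?_, ?_⟩
  · rw [e2, div_le_div_iff₀ htν (by linarith)]
    nlinarith [mul_pos hβ hν0, mul_pos (mul_pos hβ hν0) (by linarith : 0 < t)]
  · rw [e2, ← mul_div_assoc, div_le_iff₀ htν]
    have : 0 ≤ 2 * β * t := by positivity
    nlinarith [mul_nonneg this (mul_nonneg hν0.le (by linarith : 0 ≤ t - 2)), mul_nonneg this hν0.le]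
  · rw [e2, ← mul_div_assoc, le_div_iff₀ htν]
    have : 0 ≤ 2 * β * (1 - ν) := by
      have : 0 ≤ 1 - ν := by linarith
      positivity
    have h2 : (t - 2) * (t - ν) ≤ t * (t - 1) := by nlinarith
    nlinarith [mul_le_mul_of_nonneg_left h2 this]

set_option maxHeartbeats 1000000 in
/-- One step of the accelerated scheme decreases the Lyapunov function, up to the estimator error. -/
theorem lyap_step {β βbar μ α γ t η : ℝ} (hμ0 : 0 < μ) (hμ : μ < 2 / 3) (hβ : 0 < β)
    (hβb : β < (2 - μ) * βbar / (2 + μ)) (hα : 2 * β * μ * α = 1 - μ) (hγ : β * γ = 8)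
    (ht : 32 + (8 + 22 / μ) / (1 - 3 * μ / 2) ≤ t)
    (hη : (t - μ / 2) * η = 2 * β * (t - 1)) {G G₁ e u s u₁ s₁ w : H}
    (hu : u₁ = u + t⁻¹ • (s - u) - η • (G + e))
    (hs : s₁ = s - (μ / 2 * η) • (G + e)) (hG : 0 ≤ ⟪G, u - w⟫) :
    lyap β α γ t G₁ (s₁ - u₁) (s₁ - w)
        + t * (t - 1) * (⟪G₁ - G, u₁ - u⟫ - βbar * ‖G₁ - G‖ ^ 2)
        + β * (1 - 3 * μ / 2) * t * ‖G‖ ^ 2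
      ≤ lyap β α γ (t - μ) G (s - u) (s - w) + 4 * β / μ * (t * (t - 1)) * ‖e‖ ^ 2 := by
  have hμ' : 0 < 1 - 3 * μ / 2 := by linarith
  have ht32 : 32 ≤ t := by
    have : 0 ≤ (8 + 22 / μ) / (1 - 3 * μ / 2) := by positivity
    linarith
  have htc : (8 + 22 / μ) ≤ (1 - 3 * μ / 2) * t := by
    have : (8 + 22 / μ) / (1 - 3 * μ / 2) ≤ t := by linarith
    rwa [div_le_iff₀' hμ'] at this
  have ht0 : 0 < t := by linarith
  obtain ⟨hη0, hη1, hη2, hη3, hη4⟩ := eta_bounds hβ (by linarith : 0 < μ / 2) (by linarith)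
    (by linarith) hη
  have hγ0 : 0 < γ := by by_contra! h; nlinarith only [hγ, hβ, h]
  have hα0 : 0 < α := by
    by_contra! h
    nlinarith only [mul_pos hβ hμ0, h, hα, hμ]
  obtain ⟨d, rfl⟩ : ∃ d, G₁ = G + d := ⟨G₁ - G, by abel⟩
  have key := accel_step_identity ht0.ne' hη (d := d) hu hs
  -- The upper bound on `β` serves to leave `μβ ‖d‖²` of the co-coercivity free to absorb `⟪d, e⟫`.
  have hgap : μ * β ≤ βbar - β := by
    rw [lt_div_iff₀ (by linarith)] at hβb
    refine le_of_mul_le_mul_left ?_ (by linarith : 0 < 2 - μ)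
    have : 0 < μ * μ * β := by positivity
    linarith
  have hc : t ^ 2 ≤ 2 * (t * (t - 1)) := by nlinarith only [ht32]
  have hc0 : 0 < t * (t - 1) := by nlinarith only [ht32]
  -- the coupling of `d` and `e`
  have b1 : -(2 * β * (t * (t - 1))) * ⟪d, e⟫
      ≤ μ * β * (t * (t - 1)) * ‖d‖ ^ 2 + β / μ * (t * (t - 1)) * ‖e‖ ^ 2 := by
    apply neg_inner_le_of_sq (by positivity)
    apply le_of_eq
    field_simp
    ring
  have b1' : μ * β * (t * (t - 1)) * ‖d‖ ^ 2 ≤ (βbar - β) * (t * (t - 1)) * ‖d‖ ^ 2 := by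
    gcongr
  -- the coupling of `G` and `e`
  have b3 : -(t * (t - 1) * (2 * β - η)) * ⟪G, e⟫
      ≤ 4 * μ * β * ‖G‖ ^ 2 + β / (2 * μ) * (t * (t - 1)) * ‖e‖ ^ 2 := by
    apply neg_inner_le_of_sq (by positivity)
    have : 4 * (4 * μ * β) * (β / (2 * μ) * (t * (t - 1))) = 4 * β ^ 2 * (2 * (t * (t - 1))) := by
      field_simp
      ring
    rw [this, neg_sq]
    calc (t * (t - 1) * (2 * β - η)) ^ 2 ≤ (2 * β * t) ^ 2 := by
          apply pow_le_pow_left₀ _ hη3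
          apply mul_nonneg hc0.le; linarith
      _ = 4 * β ^ 2 * t ^ 2 := by ring
      _ ≤ _ := by gcongr
  set a := α + γ / t with ha
  have ha0 : 0 < a := by positivity
  have haη : a * μ * η ≤ 2 := by
    have h1 : a * μ * η ≤ a * μ * (2 * β) := by gcongr
    have h2 : a * μ * (2 * β) = (1 - μ) + 16 * μ / t := by
      rw [ha]
      have : γ = 8 / β := by field_simp; linarith
      rw [← hα, this]; field_simp; ring
    have h3 : 16 * μ / t ≤ 1 := by rw [div_le_one ht0]; linarith
    linarith
  -- `α` is chosen so that `2βμα = 1 - μ`: the coefficient of `⟪G, s - w⟫` then vanishes in the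
  -- limit and is only `O(1/t)`. The resulting `‖s - w‖²/t²` is what the term `γ/t` is there to
  -- absorb.
  have hθ : |1 - μ - a * μ * η| ≤ 13 / t := by
    have h2 : 1 - μ - a * μ * η = α * μ * (2 * β - η) - γ * μ * η / t := by
      rw [ha, ← hα]; field_simp; ring
    have h3 : α * μ * (2 * β - η) ≤ 2 / t := by
      calc α * μ * (2 * β - η) ≤ α * μ * (4 * β / t) := by gcongr
        _ = 2 * (1 - μ) / t := by rw [← hα]; field_simp; ring
        _ ≤ 2 / t := by gcongr; linarith
    have h4 : 0 ≤ α * μ * (2 * β - η) := by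
      have : 0 ≤ 2 * β - η := by linarith
      positivity
    have h5 : γ * μ * η / t ≤ 13 / t := by
      gcongr
      calc γ * μ * η ≤ γ * μ * (2 * β) := by gcongr
        _ = 16 * μ := by linear_combination 2 * μ * hγ
        _ ≤ 13 := by linarith
    have h6 : 0 ≤ γ * μ * η / t := by positivity
    have h7 : 2 / t ≤ 13 / t := by gcongr; norm_num
    rw [h2, abs_le]
    constructor <;> linarith
  -- the couplings with `s - w`
  have b4 : (1 - μ - a * μ * η) * ⟪G, s - w⟫
      ≤ 22 * β / μ * ‖G‖ ^ 2 + 2 * μ / (β * t ^ 2) * ‖s - w‖ ^ 2 := by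
    apply neg_inner_le_of_sq (by positivity)
    calc (1 - μ - a * μ * η) ^ 2 ≤ (13 / t) ^ 2 := by
          rw [← sq_abs]; exact pow_le_pow_left₀ (abs_nonneg _) hθ 2
      _ = 169 / t ^ 2 := by ring
      _ ≤ 176 / t ^ 2 := by gcongr; norm_num
      _ = _ := by field_simp; norm_num
  have b5 : -(a * μ * η) * ⟪e, s - w⟫
      ≤ β / μ * (t * (t - 1)) * ‖e‖ ^ 2 + 2 * μ / (β * t ^ 2) * ‖s - w‖ ^ 2 := by
    apply neg_inner_le_of_sq (by positivity)
    have h1 : 4 * (β / μ * (t * (t - 1))) * (2 * μ / (β * t ^ 2))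
        = 4 * (2 * (t * (t - 1)) / t ^ 2) := by field_simp
    have h2 : 1 ≤ 2 * (t * (t - 1)) / t ^ 2 := by rwa [le_div_iff₀ (by positivity), one_mul]
    rw [h1, neg_sq]
    have : (a * μ * η) ^ 2 ≤ 2 ^ 2 := pow_le_pow_left₀ (by positivity) haη 2
    linarith
  have b6 : a * (μ / 2 * η) ^ 2 * ‖G + e‖ ^ 2
      ≤ 2 * μ * β * ‖G‖ ^ 2 + β / (2 * μ) * (t * (t - 1)) * ‖e‖ ^ 2 := by
    have h1 : a * (μ / 2 * η) ^ 2 ≤ μ * β := by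
      calc a * (μ / 2 * η) ^ 2 = (a * μ * η) * (μ * η / 4) := by ring
        _ ≤ 2 * (μ * (2 * β) / 4) := by gcongr
        _ = μ * β := by ring
    have h2 : ‖G + e‖ ^ 2 ≤ 2 * ‖G‖ ^ 2 + 2 * ‖e‖ ^ 2 := by
      have := parallelogram_law_with_norm ℝ G e
      nlinarith only [this, sq_nonneg ‖G - e‖]
    have h3 : 2 * μ * β ≤ β / (2 * μ) * (t * (t - 1)) := by
      have : 2 * μ * β = β / (2 * μ) * (4 * μ ^ 2) := by field_simp; ring
      rw [this]
      gcongr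
      · linarith
      · nlinarith only [hμ0, hμ, ht32]
    calc a * (μ / 2 * η) ^ 2 * ‖G + e‖ ^ 2 ≤ μ * β * (2 * ‖G‖ ^ 2 + 2 * ‖e‖ ^ 2) := by gcongr
      _ = 2 * μ * β * ‖G‖ ^ 2 + 2 * μ * β * ‖e‖ ^ 2 := by ring
      _ ≤ _ := by gcongr
  -- the decrease of the weight of `s - w`
  have b7 : (γ / t - γ / (t - μ)) * ‖s - w‖ ^ 2 ≤ -(4 * μ / (β * t ^ 2)) * ‖s - w‖ ^ 2 := by
    gcongr
    have htμ : 0 < t - μ := by linarith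
    have hγ' : γ = 8 / β := by field_simp; linarith
    have : γ / t - γ / (t - μ) = -(8 * μ / (β * (t * (t - μ)))) := by
      rw [hγ']; field_simp; ring
    rw [this, neg_le_neg_iff, div_le_div_iff₀ (by positivity) (by positivity)]
    have : t * (t - μ) ≤ t ^ 2 := by nlinarith only [mul_pos hμ0 ht0]
    nlinarith only [mul_le_mul_of_nonneg_left this (by positivity : 0 ≤ 4 * μ * β),
      (by positivity : 0 ≤ 4 * μ * β * t ^ 2)]
  have b8 : ‖s₁ - w‖ ^ 2 = ‖s - w‖ ^ 2 - μ * η * (⟪G, s - w⟫ + ⟪e, s - w⟫)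
      + (μ / 2 * η) ^ 2 * ‖G + e‖ ^ 2 := by
    have : s₁ - w = (s - w) - (μ / 2 * η) • (G + e) := by rw [hs]; abel
    rw [this, norm_sub_sq_real, norm_smul, mul_pow, Real.norm_eq_abs, sq_abs, inner_smul_right,
      inner_add_right, real_inner_comm G, real_inner_comm e]
    ring
  have b9 : ⟪G, s - u⟫ = ⟪G, s - w⟫ - ⟪G, u - w⟫ := by
    rw [← inner_sub_right]; congr 1; abel
  -- To leading order the coefficient of `‖G‖²` is `2μβt - (2 - μ)βt = -2β(1 - 3μ/2)t`, negative
  -- because `μ < 2/3`. Half of it absorbs the bounded terms once `t` passes the threshold; the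
  -- other half is the decrease claimed.
  have b10 : (β * (t * (t - 1)) - β * ((t - μ) * (t - μ - 1))
        - t * (t - 1) * (2 * β - η)) * ‖G‖ ^ 2 + (6 * μ * β + 22 * β / μ) * ‖G‖ ^ 2
      ≤ -(β * (1 - 3 * μ / 2) * t) * ‖G‖ ^ 2 := by
    rw [← add_mul]
    gcongr
    have h1 := mul_le_mul_of_nonneg_left htc hβ.le
    have h2 : β * (8 + 22 / μ) = 8 * β + 22 * β / μ := by ring
    rw [h2] at h1
    have h3 : μ * β ≤ 2 / 3 * β := by gcongr
    have h4 : 0 ≤ μ * μ * β := by positivity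
    linarith only [h1, h3, h4, hη4, hβ]
  have b11 : 0 ≤ (1 - μ) * ⟪G, u - w⟫ := mul_nonneg (by linarith) hG
  -- In units of `(β/μ) t (t - 1) ‖e‖²`, the four Young estimates cost `1 + 1/2 + 1 + 1/2 = 3`.
  have b12 : 3 * (β / μ * (t * (t - 1)) * ‖e‖ ^ 2) ≤ 4 * β / μ * (t * (t - 1)) * ‖e‖ ^ 2 := by
    have : 4 * β / μ * (t * (t - 1)) * ‖e‖ ^ 2 = 4 * (β / μ * (t * (t - 1)) * ‖e‖ ^ 2) := by ring
    rw [this]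
    gcongr
    norm_num
  have b13 : β / (2 * μ) * (t * (t - 1)) * ‖e‖ ^ 2 = (β / μ * (t * (t - 1)) * ‖e‖ ^ 2) / 2 := by
    field_simp
  have b14 : 2 * μ / (β * t ^ 2) * ‖s - w‖ ^ 2 = (4 * μ / (β * t ^ 2) * ‖s - w‖ ^ 2) / 2 := by ring
  rw [b13] at b3 b6
  rw [b14] at b4 b5
  have hdd : G + d - G = d := by abel
  rw [hdd]
  unfold lyap
  rw [← ha, b8]
  rw [b9] at key ⊢
  have ea : γ / t = a - α := by rw [ha]; ring
  rw [ea] at b7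
  linarith only [key, b1, b1', b3, b4, b5, b6, b7, b10, b11, b12]

end OneStep

/-! ### Quasi-decreasing real sequences and the growth of `t_k`. -/

section Sequences

/-- A deterministic Robbins–Siegmund lemma: subtracting the partial sums of `c` from `a` gives a
sequence that is antitone and bounded below. -/
lemma tendsto_of_quasi_decreasing {a b c : ℕ → ℝ} {K : ℕ} {m : ℝ} (hb : ∀ k, 0 ≤ b k)
    (hc : ∀ k, 0 ≤ c k) (hcs : Summable c) (ha : ∀ k ≥ K, m ≤ a k)
    (h : ∀ k ≥ K, a (k + 1) + b k ≤ a k + c k) :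
    Summable b ∧ ∃ l, Tendsto a atTop (𝓝 l) := by
  have hcs' : Summable fun k => c (k + K) := (summable_nat_add_iff K).2 hcs
  have hC : ∀ n, ∑ i ∈ Finset.range n, c (i + K) ≤ ∑' i, c (i + K) := fun n =>
    hcs'.sum_le_tsum _ fun i _ => hc _
  have key : ∀ n, a (n + K) + ∑ i ∈ Finset.range n, b (i + K)
      ≤ a K + ∑ i ∈ Finset.range n, c (i + K) := by
    intro n
    induction n with
    | zero => simp
    | succ n ih =>
      rw [Finset.sum_range_succ, Finset.sum_range_succ]
      have := h (n + K) (by omega)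
      rw [show n + 1 + K = n + K + 1 by omega]
      linarith
  constructor
  · rw [← summable_nat_add_iff K]
    refine summable_of_sum_range_le (c := a K + ∑' i, c (i + K) - m) (fun n => hb _) fun n => ?_
    have := key n
    have := hC n
    have := ha (n + K) (by omega)
    linarith
  · have hanti : Antitone fun n => a (n + K) - ∑ i ∈ Finset.range n, c (i + K) := by
      refine antitone_nat_of_succ_le fun n => ?_
      rw [Finset.sum_range_succ, show n + 1 + K = n + K + 1 by omega]
      have := h (n + K) (by omega)
      have := hb (n + K)
      linarith
    have hbdd : BddBelow (Set.range fun n => a (n + K) - ∑ i ∈ Finset.range n, c (i + K)) := by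
      refine ⟨m - ∑' i, c (i + K), ?_⟩
      rintro _ ⟨n, rfl⟩
      have := hC n
      have := ha (n + K) (by omega)
      dsimp only
      linarith
    have h1 := tendsto_atTop_ciInf hanti hbdd
    have h2 := h1.add hcs'.hasSum.tendsto_sum_nat
    refine ⟨_, (tendsto_add_atTop_iff_nat K).1 (h2.congr fun n => ?_)⟩
    ring

lemma tPar_tendsto {μ : ℝ} (hμ : 0 < μ) (r : ℝ) :
    Tendsto (fun k : ℕ => tPar μ r k) atTop atTop := by
  unfold tPar
  push_cast
  exact (tendsto_natCast_atTop_atTop.atTop_add tendsto_const_nhds).const_mul_atTop hμ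

lemma tPar_succ (μ r : ℝ) (k : ℕ) : tPar μ r (k + 1 : ℕ) = tPar μ r k + μ := by
  unfold tPar; push_cast; ring

lemma tPar_sub_one (μ r : ℝ) (k : ℕ) : tPar μ r ((k : ℤ) - 1) = tPar μ r k - μ := by
  unfold tPar; push_cast; ring

lemma one_add_le_tPar {μ r : ℝ} (hμ : 0 < μ) (hr : 2 + 1 / μ ≤ r) (k : ℕ) :
    1 + 2 * μ + μ * k ≤ tPar μ r k := by
  unfold tPar
  have h1 : μ * (2 + 1 / μ) ≤ μ * r := by gcongr
  have h2 : μ * (2 + 1 / μ) = 2 * μ + 1 := by field_simp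
  push_cast
  linarith

lemma tPar_le {μ r : ℝ} (hμ : 0 < μ) (hr : 2 + 1 / μ ≤ r) (k : ℕ) :
    tPar μ r k ≤ μ * r * (k + 1) := by
  unfold tPar
  have : 1 ≤ r := by have : 0 < 1 / μ := by positivity
                     linarith
  have h : (k : ℝ) ≤ r * k := le_mul_of_one_le_left (by positivity) this
  push_cast
  nlinarith

lemma not_summable_inv_tPar {μ r : ℝ} (hμ : 0 < μ) (hr : 2 + 1 / μ ≤ r) :
    ¬ Summable fun k : ℕ => 1 / tPar μ r k := by
  intro h
  have h0 : 0 < r := by have : 0 < 1 / μ := by positivity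
                        linarith
  have h1 : Summable fun k : ℕ => 1 / ((k : ℝ) + 1) := by
    refine Summable.of_nonneg_of_le (fun k => by positivity) (fun k => ?_) (h.mul_left (μ * r))
    have ht : 0 < tPar μ r k := by
      have := one_add_le_tPar hμ hr k
      have : 0 ≤ μ * k := by positivity
      linarith
    rw [mul_one_div, div_le_div_iff₀ (by positivity) ht, one_mul]
    exact tPar_le hμ hr k
  have h2 := (summable_nat_add_iff (f := fun k : ℕ => 1 / (k : ℝ)) 1).1 (by push_cast; exact h1)
  exact Real.not_summable_one_div_natCast h2

/-- A positive limit would make `∑ 1/t_k` converge, whereas `t_k` grows linearly. -/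
lemma tendsto_zero_of_summable_div {μ r : ℝ} (hμ : 0 < μ) (hr : 2 + 1 / μ ≤ r) {f : ℕ → ℝ}
    (hf : ∀ᶠ k in atTop, 0 ≤ f k) {l : ℝ} (hl : Tendsto f atTop (𝓝 l))
    (hs : Summable fun k : ℕ => f k / tPar μ r k) : Tendsto f atTop (𝓝 0) := by
  rcases (ge_of_tendsto hl hf).eq_or_lt with h | h
  · rwa [h]
  exfalso
  apply not_summable_inv_tPar hμ hr
  have hev : ∀ᶠ k in atTop, l / 2 < f k := hl.eventually_const_lt (by linarith)
  refine Summable.of_norm_bounded_eventually_nat (hs.mul_left (2 / l)) ?_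
  filter_upwards [hev] with k hk
  have ht : 0 < tPar μ r k := by
    have := one_add_le_tPar hμ hr k
    have : 0 ≤ μ * k := by positivity
    linarith
  rw [Real.norm_of_nonneg (by positivity), ← mul_div_assoc]
  gcongr
  rw [div_mul_eq_mul_div, le_div_iff₀ h]
  linarith

end Sequences

/-! ### The Lyapunov function along the scheme. -/

section Scheme

variable {H : Type*} [NormedAddCommGroup H] [InnerProductSpace ℝ H]

/-- Since `⟪G, u - w⟫ ≥ 0`, the momentum `s - u` may be replaced by `s - w` in the cross term. What
remains is essentially the form `β X² - ⟪X, Y⟫ + α Y²` in `X = tG` and `Y = s - w`, positive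
definite when `4αβ > 1`. For `t ≥ β/ε` the lower-order loss `βt ‖G‖²` is below `ε t² ‖G‖²`. -/
lemma exists_lyap_lower {β α γ : ℝ} (hβ : 0 < β) (hα : 0 < α) (hαβ : 1 < 4 * α * β)
    (hγ : 0 ≤ γ) :
    ∃ ε > 0, ∃ T > 0, ∀ t ≥ T, ∀ G u s w : H, 0 ≤ ⟪G, u - w⟫ →
      ε * (t ^ 2 * ‖G‖ ^ 2 + ‖s - w‖ ^ 2) ≤ lyap β α γ t G (s - u) (s - w) := by
  set ε := (4 * α * β - 1) / (4 * (β + 2 * α)) with hε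
  have hε0 : 0 < ε := div_pos (by linarith) (by positivity)
  have e1 : ε * (4 * (β + 2 * α)) = 4 * α * β - 1 := by rw [hε]; field_simp
  have hεβ : 0 < β - 2 * ε := by
    by_contra! h
    nlinarith [mul_pos hε0 hβ]
  refine ⟨ε, hε0, β / ε, by positivity, fun t ht G u s w h => ?_⟩
  have ht0 : 0 < t := lt_of_lt_of_le (by positivity) ht
  have h1 : β * t ≤ ε * t ^ 2 := by
    rw [ge_iff_le, div_le_iff₀ hε0] at ht
    nlinarith
  have h2 := neg_inner_le_of_sq (a := t • G) (b := s - w) (m := 1) hεβ (B := α - ε) (by nlinarith)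
  rw [inner_smul_left, norm_smul, mul_pow, Real.norm_eq_abs, sq_abs] at h2
  simp only [conj_trivial, one_mul] at h2
  have h3 : ⟪G, s - u⟫ = ⟪G, s - w⟫ - ⟪G, u - w⟫ := by
    rw [← inner_sub_right]; congr 1; abel
  have h4 : 0 ≤ t * ⟪G, u - w⟫ := by positivity
  have h5 : 0 ≤ γ / t * ‖s - w‖ ^ 2 := by positivity
  have h6 : β * t * ‖G‖ ^ 2 ≤ ε * t ^ 2 * ‖G‖ ^ 2 := by gcongr
  unfold lyap
  rw [h3]
  linarith

/-- The parameters of the accelerated scheme. -/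
structure AccelParams (β βbar μ r : ℝ) : Prop where
  mu_pos : 0 < μ
  mu_lt : μ < 2 / 3
  beta_pos : 0 < β
  beta_lt : β < (2 - μ) * βbar / (2 + μ)
  le_r : 2 + 1 / μ ≤ r

namespace AccelParams

variable {β βbar μ r : ℝ} (hp : AccelParams β βbar μ r)
include hp

lemma betaBar_pos : 0 < βbar := by
  have := hp.mu_pos; have := hp.mu_lt; have := hp.beta_pos
  have h := hp.beta_lt
  rw [lt_div_iff₀ (by linarith)] at h
  by_contra! h'
  nlinarith

lemma one_lt_tPar (k : ℕ) : 1 + 2 * μ ≤ tPar μ r k := by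
  have := one_add_le_tPar hp.mu_pos hp.le_r k
  have := hp.mu_pos
  have : 0 ≤ μ * k := by positivity
  linarith

lemma tPar_pos (k : ℕ) : 0 < tPar μ r k := by
  have := hp.one_lt_tPar k
  have := hp.mu_pos
  linarith

lemma eta_eq (k : ℕ) :
    (tPar μ r k - μ / 2) * etaPar μ r (μ / 2) β k = 2 * β * (tPar μ r k - 1) := by
  have := hp.one_lt_tPar k
  have := hp.mu_pos
  have h : tPar μ r k - μ / 2 ≠ 0 := by linarith
  exact mul_div_cancel₀ _ h

lemma eta_nonneg (k : ℕ) : 0 ≤ etaPar μ r (μ / 2) β k := by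
  have := hp.one_lt_tPar k
  have := hp.mu_pos
  have := hp.beta_pos
  unfold etaPar
  apply div_nonneg
  · apply mul_nonneg <;> linarith
  · linarith

lemma eta_le (k : ℕ) : etaPar μ r (μ / 2) β k ≤ 2 * β := by
  have := hp.one_lt_tPar k
  have := hp.mu_pos
  have := hp.mu_lt
  have := hp.beta_pos
  unfold etaPar
  rw [div_le_iff₀ (by linarith)]
  gcongr
  linarith

end AccelParams

/-- The weight `α` of the Lyapunov function. -/
noncomputable def lyapAlpha (β μ : ℝ) : ℝ := (1 - μ) / (2 * β * μ)

/-- The accelerated scheme with residuals `G k` and errors `e k`. -/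
structure AccelScheme (β βbar μ r : ℝ) (G e u s : ℕ → H) : Prop where
  u_succ : ∀ k : ℕ, u (k + 1) = u k + (tPar μ r k)⁻¹ • (s k - u k)
    - etaPar μ r (μ / 2) β k • (G k + e k)
  s_succ : ∀ k : ℕ, s (k + 1) = s k - (μ / 2 * etaPar μ r (μ / 2) β k) • (G k + e k)
  cocoercive : ∀ k : ℕ, βbar * ‖G (k + 1) - G k‖ ^ 2 ≤ ⟪G (k + 1) - G k, u (k + 1) - u k⟫

/-- The Lyapunov function along the scheme. -/
noncomputable def lyapSeq (β μ r : ℝ) (G u s : ℕ → H) (w : H) (k : ℕ) : ℝ :=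
  lyap β (lyapAlpha β μ) (8 / β) (tPar μ r k - μ) (G k) (s k - u k) (s k - w)

variable {β βbar μ r : ℝ}

/-- Beyond a deterministic index, the Lyapunov function is coercive and decreases up to the
estimator error. -/
theorem exists_lyapSeq_step (hp : AccelParams β βbar μ r) :
    ∃ ε > 0, ∃ K : ℕ, ∀ G e u s : ℕ → H, AccelScheme β βbar μ r G e u s → ∀ w : H,
      ∀ k ≥ K, 0 ≤ ⟪G k, u k - w⟫ →
      ε * ((tPar μ r k - μ) ^ 2 * ‖G k‖ ^ 2 + ‖s k - w‖ ^ 2) ≤ lyapSeq β μ r G u s w k ∧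
      lyapSeq β μ r G u s w (k + 1)
        + tPar μ r k * (tPar μ r k - 1)
          * (⟪G (k + 1) - G k, u (k + 1) - u k⟫ - βbar * ‖G (k + 1) - G k‖ ^ 2)
        + β * (1 - 3 * μ / 2) * tPar μ r k * ‖G k‖ ^ 2
      ≤ lyapSeq β μ r G u s w k
        + 4 * β / μ * (tPar μ r k * (tPar μ r k - 1)) * ‖e k‖ ^ 2 := by
  have hμ := hp.mu_pos; have hμ2 := hp.mu_lt; have hβ := hp.beta_pos
  have hα : 2 * β * μ * lyapAlpha β μ = 1 - μ := by unfold lyapAlpha; field_simp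
  have hα0 : 0 < lyapAlpha β μ := div_pos (by linarith) (by positivity)
  -- `4αβ = 2(1 - μ)/μ`, so coercivity is again the condition `μ < 2/3`.
  have hαβ : 1 < 4 * lyapAlpha β μ * β := by
    have : 4 * lyapAlpha β μ * β = 2 * (1 - μ) / μ := by unfold lyapAlpha; field_simp; ring
    rw [this, lt_div_iff₀ hμ]
    linarith
  obtain ⟨ε, hε, T, hT, hlow⟩ :=
    exists_lyap_lower (H := H) hβ hα0 hαβ (by positivity : 0 ≤ 8 / β)
  have hev := (tPar_tendsto hμ r).eventually_ge_atTop
    (max (T + μ) (32 + (8 + 22 / μ) / (1 - 3 * μ / 2)))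
  obtain ⟨K, hK⟩ := eventually_atTop.1 hev
  refine ⟨ε, hε, K, fun G e u s hs w k hk hG => ⟨?_, ?_⟩⟩
  · exact hlow _ (by linarith [le_trans (le_max_left _ _) (hK k hk)]) _ _ _ _ hG
  · have := lyap_step hμ hμ2 hβ hp.beta_lt hα (mul_div_cancel₀ 8 hβ.ne') (le_trans (le_max_right _ _) (hK k hk))
      (hp.eta_eq k) (hs.u_succ k) (hs.s_succ k) (G₁ := G (k + 1)) hG
    -- At index `k` the Lyapunov function carries the parameter `t_{k-1} = t_k - μ`, so the step
    -- from `k` to `k + 1` uses `t_k`.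
    unfold lyapSeq
    rwa [tPar_succ, add_sub_cancel_right]

end Scheme

/-! ### Pathwise convergence under summable weighted errors. -/

section Convergence

variable {H : Type*} [NormedAddCommGroup H] [InnerProductSpace ℝ H]

lemma norm_add_sq_le_two (a b : H) : ‖a + b‖ ^ 2 ≤ 2 * ‖a‖ ^ 2 + 2 * ‖b‖ ^ 2 := by
  have := parallelogram_law_with_norm ℝ a b
  nlinarith [sq_nonneg ‖a - b‖]

lemma norm_convex_comb_sq_le {c : ℝ} (h0 : 0 ≤ c) (h1 : c ≤ 1) (a b : H) :
    ‖(1 - c) • a + c • b‖ ^ 2 ≤ (1 - c) * ‖a‖ ^ 2 + c * ‖b‖ ^ 2 := by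
  have h : ‖(1 - c) • a + c • b‖ ≤ (1 - c) * ‖a‖ + c * ‖b‖ := by
    refine (norm_add_le _ _).trans ?_
    rw [norm_smul, norm_smul, Real.norm_of_nonneg h0, Real.norm_of_nonneg (by linarith)]
  have h2 := pow_le_pow_left₀ (norm_nonneg _) h 2
  have h3 : 0 ≤ c * (1 - c) * (‖a‖ - ‖b‖) ^ 2 := by
    have : 0 ≤ 1 - c := by linarith
    positivity
  nlinarith

variable {β βbar μ r : ℝ} {G e u s : ℕ → H}

namespace AccelScheme

/-- The momentum `s k - u k` is averaged with the residuals. -/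
lemma momentum_succ (hp : AccelParams β βbar μ r) (hs : AccelScheme β βbar μ r G e u s) (k : ℕ) :
    s (k + 1) - u (k + 1) = (1 - 1 / tPar μ r k) • (s k - u k)
      + (1 / tPar μ r k) • (((1 - μ / 2) * etaPar μ r (μ / 2) β k * tPar μ r k) • (G k + e k)) := by
  have ht := (hp.tPar_pos k).ne'
  rw [smul_smul, show 1 / tPar μ r k * ((1 - μ / 2) * etaPar μ r (μ / 2) β k * tPar μ r k)
    = (1 - μ / 2) * etaPar μ r (μ / 2) β k by field_simp, hs.u_succ, hs.s_succ]
  module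

variable (hp : AccelParams β βbar μ r) (hs : AccelScheme β βbar μ r G e u s)
  (he : Summable fun k : ℕ => tPar μ r k ^ 2 * ‖e k‖ ^ 2)
include hp hs he

/-- Beyond `K` the Lyapunov step is a quasi-descent with summable perturbation, the co-coercivity
gap being dropped. Coercivity then converts boundedness of the values into the two bounds. -/
lemma lyapSeq_convergence {w : H} (hw : ∀ k, 0 ≤ ⟪G k, u k - w⟫) :
    (Summable fun k : ℕ => tPar μ r k * ‖G k‖ ^ 2) ∧
    (∃ R, ∀ᶠ k : ℕ in atTop, tPar μ r k * ‖G k‖ ≤ R ∧ ‖s k - w‖ ≤ R) ∧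
    ∃ l, Tendsto (lyapSeq β μ r G u s w) atTop (𝓝 l) := by
  obtain ⟨ε, hε, K, hK⟩ := exists_lyapSeq_step (H := H) hp
  have hμ := hp.mu_pos; have hμ2 := hp.mu_lt; have hβ := hp.beta_pos
  have hstep := fun k hk => hK G e u s hs w k hk (hw k)
  have h12 : 0 < 1 - 3 * μ / 2 := by linarith
  have hsum := (tendsto_of_quasi_decreasing (K := K) (m := 0) (a := lyapSeq β μ r G u s w)
    (b := fun k => β * (1 - 3 * μ / 2) * (tPar μ r k * ‖G k‖ ^ 2))
    (c := fun k => 4 * β / μ * (tPar μ r k ^ 2 * ‖e k‖ ^ 2))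
    (fun k => by have := (hp.tPar_pos k).le; positivity) (fun k => by positivity)
    (he.mul_left _) (fun k hk => le_trans (by positivity) (hstep k hk).1) (fun k hk => by
      have h1 := (hstep k hk).2
      have ht := hp.one_lt_tPar k
      have h2 : 0 ≤ tPar μ r k * (tPar μ r k - 1)
          * (⟪G (k + 1) - G k, u (k + 1) - u k⟫ - βbar * ‖G (k + 1) - G k‖ ^ 2) := by
        apply mul_nonneg (mul_nonneg (by linarith) (by linarith))
        linarith [hs.cocoercive k]
      have h3 : 4 * β / μ * (tPar μ r k * (tPar μ r k - 1)) * ‖e k‖ ^ 2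
          ≤ 4 * β / μ * (tPar μ r k ^ 2 * ‖e k‖ ^ 2) := by
        rw [mul_assoc (4 * β / μ)]
        gcongr
        nlinarith
      linarith))
  obtain ⟨h1, l, hl⟩ := hsum
  refine ⟨?_, ?_, l, hl⟩
  · exact (summable_mul_left_iff (by positivity)).1 h1
  · have hb : ∀ᶠ k in atTop, lyapSeq β μ r G u s w k < l + 1 :=
      hl.eventually_lt_const (by linarith)
    set M := (l + 1) / ε with hM
    refine ⟨2 * (M + 1), ?_⟩
    filter_upwards [hb, eventually_ge_atTop K] with k hk hkK
    have h2 : (tPar μ r k - μ) ^ 2 * ‖G k‖ ^ 2 + ‖s k - w‖ ^ 2 ≤ M := by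
      rw [hM, le_div_iff₀ hε]
      linarith [(hstep k hkK).1]
    have hM0 : 0 ≤ M := le_trans (by positivity) h2
    have hG2 : ((tPar μ r k - μ) * ‖G k‖) ^ 2 ≤ M := by
      rw [mul_pow]; linarith [sq_nonneg ‖s k - w‖]
    have hq2 : ‖s k - w‖ ^ 2 ≤ M := by
      have : 0 ≤ (tPar μ r k - μ) ^ 2 * ‖G k‖ ^ 2 := by positivity
      linarith
    have ht := hp.one_lt_tPar k
    have hle : ∀ x : ℝ, x ^ 2 ≤ M → x ≤ M + 1 := fun x hx => by nlinarith [sq_nonneg (x - 1)]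
    constructor
    · have h3 := hle _ hG2
      have h4 : tPar μ r k * ‖G k‖ ≤ 2 * ((tPar μ r k - μ) * ‖G k‖) := by
        rw [← mul_assoc]
        gcongr
        linarith
      linarith
    · linarith [hle _ hq2]

/-- By `momentum_succ` and convexity of the squared norm, `‖s - u‖²` drops by `‖s - u‖²/t` up to a
multiple of `t ‖G + e‖²`, which is summable. The limit therefore exists, and the divergence of `∑
1/t` makes it zero. -/
lemma momentum_convergence (hG : Summable fun k : ℕ => tPar μ r k * ‖G k‖ ^ 2) :
    (Summable fun k : ℕ => ‖s k - u k‖ ^ 2 / tPar μ r k) ∧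
    Tendsto (fun k => ‖s k - u k‖) atTop (𝓝 0) := by
  have hμ := hp.mu_pos; have hμ2 := hp.mu_lt; have hβ := hp.beta_pos
  have hsum : Summable fun k : ℕ => (2 * β) ^ 2 * (2 * (tPar μ r k * ‖G k‖ ^ 2)
      + 2 * (tPar μ r k ^ 2 * ‖e k‖ ^ 2)) :=
    ((hG.mul_left 2).add (he.mul_left 2)).mul_left _
  have h := tendsto_of_quasi_decreasing (K := 0) (m := 0) (a := fun k => ‖s k - u k‖ ^ 2)
    (b := fun k => ‖s k - u k‖ ^ 2 / tPar μ r k) (fun k => by have := (hp.tPar_pos k).le; positivity)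
    (fun k => by have := (hp.tPar_pos k).le; positivity) hsum (fun k _ => by positivity)
    (fun k _ => by
      have ht := hp.one_lt_tPar k
      have ht0 := hp.tPar_pos k
      rw [momentum_succ hp hs]
      have h1 := norm_convex_comb_sq_le (c := 1 / tPar μ r k) (by positivity)
        (by rw [div_le_one ht0]; linarith) (s k - u k)
        (((1 - μ / 2) * etaPar μ r (μ / 2) β k * tPar μ r k) • (G k + e k))
      have h2 : 1 / tPar μ r k
          * ‖((1 - μ / 2) * etaPar μ r (μ / 2) β k * tPar μ r k) • (G k + e k)‖ ^ 2
          = ((1 - μ / 2) * etaPar μ r (μ / 2) β k) ^ 2 * (tPar μ r k * ‖G k + e k‖ ^ 2) := by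
        rw [norm_smul, mul_pow, Real.norm_eq_abs, sq_abs]
        field_simp
      have h3 : ((1 - μ / 2) * etaPar μ r (μ / 2) β k) ^ 2 ≤ (2 * β) ^ 2 := by
        have hη0 := hp.eta_nonneg k
        have hη1 := hp.eta_le k
        have h12 : 0 ≤ 1 - μ / 2 := by linarith
        apply pow_le_pow_left₀ (by positivity)
        nlinarith
      have h4 : tPar μ r k * ‖G k + e k‖ ^ 2
          ≤ 2 * (tPar μ r k * ‖G k‖ ^ 2) + 2 * (tPar μ r k ^ 2 * ‖e k‖ ^ 2) := by
        have h5 : tPar μ r k * ‖e k‖ ^ 2 ≤ tPar μ r k ^ 2 * ‖e k‖ ^ 2 := by gcongr; nlinarith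
        have h6 := mul_le_mul_of_nonneg_left (norm_add_sq_le_two (G k) (e k)) ht0.le
        linarith
      have h7 : ((1 - μ / 2) * etaPar μ r (μ / 2) β k) ^ 2 * (tPar μ r k * ‖G k + e k‖ ^ 2)
          ≤ (2 * β) ^ 2 * (2 * (tPar μ r k * ‖G k‖ ^ 2) + 2 * (tPar μ r k ^ 2 * ‖e k‖ ^ 2)) := by
        gcongr
      have h8 : ‖s k - u k‖ ^ 2 / tPar μ r k = 1 / tPar μ r k * ‖s k - u k‖ ^ 2 := by ring
      linarith)
  obtain ⟨h1, l, hl⟩ := h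
  refine ⟨h1, ?_⟩
  have h2 := tendsto_zero_of_summable_div hμ hp.le_r (Eventually.of_forall fun k => by positivity)
    hl h1
  have h3 := h2.sqrt
  simpa [Real.sqrt_sq] using h3

omit he in
lemma increment_bound (k : ℕ) : tPar μ r k * ‖u (k + 1) - u k‖
    ≤ ‖s k - u k‖ + 2 * β * (tPar μ r k * ‖G k‖ + tPar μ r k * ‖e k‖) := by
  have ht0 := hp.tPar_pos k
  have h1 : tPar μ r k • (u (k + 1) - u k)
      = (s k - u k) - (etaPar μ r (μ / 2) β k * tPar μ r k) • (G k + e k) := by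
    rw [hs.u_succ, show u k + (tPar μ r k)⁻¹ • (s k - u k) - etaPar μ r (μ / 2) β k • (G k + e k)
      - u k = (tPar μ r k)⁻¹ • (s k - u k) - etaPar μ r (μ / 2) β k • (G k + e k) by abel,
      smul_sub, smul_smul, smul_smul, mul_inv_cancel₀ ht0.ne', one_smul, mul_comm]
  have h2 : tPar μ r k * ‖u (k + 1) - u k‖ = ‖tPar μ r k • (u (k + 1) - u k)‖ := by
    rw [norm_smul, Real.norm_of_nonneg ht0.le]
  have hη0 := hp.eta_nonneg k
  have hη1 := hp.eta_le k
  have hβ := hp.beta_pos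
  rw [h2, h1]
  refine (norm_sub_le _ _).trans ?_
  rw [norm_smul, Real.norm_of_nonneg (by positivity)]
  refine add_le_add_right ?_ _
  calc etaPar μ r (μ / 2) β k * tPar μ r k * ‖G k + e k‖
      ≤ 2 * β * tPar μ r k * (‖G k‖ + ‖e k‖) := by gcongr; exact norm_add_le _ _
    _ = _ := by ring

end AccelScheme

/-- Pathwise convergence of the accelerated scheme with square-summable weighted errors. -/
theorem AccelScheme.convergence (hp : AccelParams β βbar μ r)
    (hs : AccelScheme β βbar μ r G e u s)
    (he : Summable fun k : ℕ => tPar μ r k ^ 2 * ‖e k‖ ^ 2)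
    {w₀ : H} (hw₀ : ∀ k, 0 ≤ ⟪G k, u k - w₀⟫) :
    (Summable fun k : ℕ => tPar μ r k * ‖G k‖ ^ 2) ∧
    (Summable fun k : ℕ => tPar μ r k * ‖u (k + 1) - u k‖ ^ 2) ∧
    Tendsto (fun k : ℕ => tPar μ r k * ‖G k‖) atTop (𝓝 0) ∧
    Tendsto (fun k : ℕ => tPar μ r k * ‖u (k + 1) - u k‖) atTop (𝓝 0) ∧
    ∀ w : H, (∀ k, 0 ≤ ⟪G k, u k - w⟫) → ∃ l, Tendsto (fun k => ‖u k - w‖) atTop (𝓝 l) := by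
  have hμ := hp.mu_pos; have hμ2 := hp.mu_lt; have hβ := hp.beta_pos
  obtain ⟨hG, ⟨R₀, hR₀⟩, -⟩ := lyapSeq_convergence hp hs he hw₀
  obtain ⟨hz, hz0⟩ := momentum_convergence hp hs he hG
  have hte : Tendsto (fun k : ℕ => tPar μ r k * ‖e k‖) atTop (𝓝 0) := by
    have h1 := he.tendsto_atTop_zero.sqrt
    rw [Real.sqrt_zero] at h1
    refine h1.congr fun k => ?_
    rw [← mul_pow, Real.sqrt_sq]
    have := (hp.tPar_pos k).le
    positivity
  -- distances of the averaged sequence to admissible points converge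
  have hsw : ∀ w : H, (∀ k, 0 ≤ ⟪G k, u k - w⟫) →
      ∃ l, Tendsto (fun k => ‖s k - w‖ ^ 2) atTop (𝓝 l) := by
    intro w hw
    obtain ⟨-, ⟨R, hR⟩, -⟩ := lyapSeq_convergence hp hs he hw
    obtain ⟨K, hK⟩ := eventually_atTop.1 hR
    have hR0 : 0 ≤ R := le_trans (norm_nonneg _) (hK K le_rfl).2
    -- The error enters `‖s - w‖²` linearly, through `⟪e, s - w⟫`. As `s - w` is bounded, `‖e‖ ≤ t²
    -- ‖e‖² + 1/t²` makes this contribution summable.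
    have hinv : Summable fun k : ℕ => 1 / tPar μ r k ^ 2 := by
      have h1 : Summable fun k : ℕ => 1 / μ ^ 2 * (1 / ((k : ℝ) + 1) ^ 2) := by
        apply Summable.mul_left
        exact_mod_cast (summable_nat_add_iff 1).2
          (Real.summable_one_div_nat_pow.2 (by norm_num : 1 < 2))
      refine Summable.of_nonneg_of_le (fun k => by positivity) (fun k => ?_) h1
      rw [div_mul_div_comm, one_mul, ← mul_pow]
      have := one_add_le_tPar hμ hp.le_r k
      apply one_div_le_one_div_of_le (by positivity)
      apply pow_le_pow_left₀ (by positivity)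
      nlinarith
    have hc : Summable fun k : ℕ => 2 * β * (tPar μ r k * ‖G k‖ ^ 2 + ‖s k - u k‖ ^ 2 / tPar μ r k)
        + 2 * β * R * (tPar μ r k ^ 2 * ‖e k‖ ^ 2 + 1 / tPar μ r k ^ 2)
        + (2 * β) ^ 2 * (2 * (tPar μ r k * ‖G k‖ ^ 2) + 2 * (tPar μ r k ^ 2 * ‖e k‖ ^ 2)) :=
      (((hG.add hz).mul_left _).add ((he.add hinv).mul_left _)).add
        (((hG.mul_left 2).add (he.mul_left 2)).mul_left _)
    refine (tendsto_of_quasi_decreasing (K := K) (m := 0) (a := fun k => ‖s k - w‖ ^ 2)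
      (b := fun _ => 0) (fun _ => le_rfl) (fun k => by
        have := (hp.tPar_pos k).le
        positivity) hc (fun k _ => by positivity) (fun k hk => ?_)).2
    have ht := hp.one_lt_tPar k
    have ht0 := hp.tPar_pos k
    have hη0 := hp.eta_nonneg k
    have hη1 := hp.eta_le k
    set η := etaPar μ r (μ / 2) β k
    set t := tPar μ r k
    have b8 : ‖s (k + 1) - w‖ ^ 2 = ‖s k - w‖ ^ 2 - μ * η * (⟪G k, s k - w⟫ + ⟪e k, s k - w⟫)
        + (μ / 2 * η) ^ 2 * ‖G k + e k‖ ^ 2 := by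
      have : s (k + 1) - w = (s k - w) - (μ / 2 * η) • (G k + e k) := by rw [hs.s_succ]; abel
      rw [this, norm_sub_sq_real, norm_smul, mul_pow, Real.norm_eq_abs, sq_abs, inner_smul_right,
        inner_add_right, real_inner_comm (G k), real_inner_comm (e k)]
      ring
    have b9 : ⟪G k, s k - w⟫ = ⟪G k, s k - u k⟫ + ⟪G k, u k - w⟫ := by
      rw [← inner_add_right]; congr 1; abel
    -- Young's inequality with weight `t`: both halves are already known to be summable.
    have b1 : -⟪G k, s k - u k⟫ ≤ t * ‖G k‖ ^ 2 + ‖s k - u k‖ ^ 2 / t := by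
      have := neg_inner_le_of_sq (a := G k) (b := s k - u k) (m := -1) (A := t) (B := 1 / t) ht0
        (by rw [mul_assoc, mul_one_div_cancel ht0.ne']; norm_num)
      rw [one_div_mul_eq_div] at this
      linarith
    have b2 : -⟪e k, s k - w⟫ ≤ R * (t ^ 2 * ‖e k‖ ^ 2 + 1 / t ^ 2) := by
      have h1 : -⟪e k, s k - w⟫ ≤ ‖e k‖ * R :=
        calc -⟪e k, s k - w⟫ ≤ |⟪e k, s k - w⟫| := neg_le_abs _
          _ ≤ ‖e k‖ * ‖s k - w‖ := abs_real_inner_le_norm _ _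
          _ ≤ ‖e k‖ * R := by gcongr; exact (hK k hk).2
      have h2 : ‖e k‖ ≤ t ^ 2 * ‖e k‖ ^ 2 + 1 / t ^ 2 := by
        have h3 : t ^ 2 * ‖e k‖ ^ 2 + 1 / t ^ 2 = (t * ‖e k‖ - 1 / t) ^ 2 + 2 * ‖e k‖ := by
          field_simp; ring
        rw [h3]
        nlinarith [sq_nonneg (t * ‖e k‖ - 1 / t), norm_nonneg (e k)]
      nlinarith [mul_le_mul_of_nonneg_left h2 hR0]
    have hμη0 : 0 ≤ μ * η := by positivity
    have hμη : μ * η ≤ 2 * β := by nlinarith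
    have b3 : μ * η * (-⟪G k, s k - u k⟫) ≤ 2 * β * (t * ‖G k‖ ^ 2 + ‖s k - u k‖ ^ 2 / t) :=
      calc _ ≤ μ * η * (t * ‖G k‖ ^ 2 + ‖s k - u k‖ ^ 2 / t) := by gcongr
        _ ≤ _ := by gcongr
    have b4 : μ * η * (-⟪e k, s k - w⟫) ≤ 2 * β * (R * (t ^ 2 * ‖e k‖ ^ 2 + 1 / t ^ 2)) :=
      calc _ ≤ μ * η * (R * (t ^ 2 * ‖e k‖ ^ 2 + 1 / t ^ 2)) := by gcongr
        _ ≤ _ := by gcongr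
    have b5 : (μ / 2 * η) ^ 2 * ‖G k + e k‖ ^ 2
        ≤ (2 * β) ^ 2 * (2 * (t * ‖G k‖ ^ 2) + 2 * (t ^ 2 * ‖e k‖ ^ 2)) := by
      refine mul_le_mul ?_ ?_ (by positivity) (by positivity)
      · exact pow_le_pow_left₀ (by positivity) (by linarith) 2
      · refine (norm_add_sq_le_two _ _).trans ?_
        have h1 : ‖G k‖ ^ 2 ≤ t * ‖G k‖ ^ 2 := le_mul_of_one_le_left (by positivity) (by linarith)
        have h2 : ‖e k‖ ^ 2 ≤ t ^ 2 * ‖e k‖ ^ 2 :=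
          le_mul_of_one_le_left (by positivity) (one_le_pow₀ (by linarith))
        linarith
    have b6 := mul_nonneg hμη0 (hw k)
    rw [b8, b9]
    linarith
  -- the rate of the residual
  have htG : Tendsto (fun k : ℕ => tPar μ r k * ‖G k‖) atTop (𝓝 0) := by
    obtain ⟨l₁, hl₁⟩ := hsw w₀ hw₀
    obtain ⟨-, -, l₂, hl₂⟩ := lyapSeq_convergence hp hs he hw₀
    have htinv : Tendsto (fun k : ℕ => (tPar μ r k - μ)⁻¹) atTop (𝓝 0) :=
      tendsto_inv_atTop_zero.comp (tendsto_atTop_add_const_right _ (-μ) (tPar_tendsto hμ r))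
    have hGz : Tendsto (fun k : ℕ => (tPar μ r k - μ) * ⟪G k, s k - u k⟫) atTop (𝓝 0) := by
      have h1 : Tendsto (fun k => R₀ * ‖s k - u k‖) atTop (𝓝 0) := by
        simpa using hz0.const_mul R₀
      refine squeeze_zero_norm' ?_ h1
      filter_upwards [hR₀] with k hk
      have ht := hp.one_lt_tPar k
      rw [norm_mul, Real.norm_of_nonneg (by linarith)]
      calc (tPar μ r k - μ) * ‖⟪G k, s k - u k⟫‖
          ≤ tPar μ r k * (‖G k‖ * ‖s k - u k‖) := by
            refine mul_le_mul (by linarith) (norm_inner_le_norm _ _) (by positivity)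
              (hp.tPar_pos k).le
        _ = tPar μ r k * ‖G k‖ * ‖s k - u k‖ := by ring
        _ ≤ _ := by gcongr; exact hk.1
    -- Solving the Lyapunov function for its leading term: the function itself, the cross term and
    -- the distance term all converge, so the weighted residual has a limit.
    have h1 : Tendsto (fun k : ℕ => β * ((tPar μ r k - μ) * (tPar μ r k - μ - 1)) * ‖G k‖ ^ 2) atTop
        (𝓝 (l₂ + 0 - (lyapAlpha β μ + 8 / β * 0) * l₁)) := by
      refine ((hl₂.add hGz).sub (((htinv.const_mul (8 / β)).const_add _).mul hl₁)).congr fun k => ?_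
      unfold lyapSeq lyap
      rw [div_eq_mul_inv (8 / β)]
      ring
    have hev : ∀ᶠ k : ℕ in atTop, 2 * μ + 2 ≤ tPar μ r k :=
      (tPar_tendsto hμ r).eventually_ge_atTop _
    have h2 := tendsto_zero_of_summable_div hμ hp.le_r (by
        filter_upwards [hev] with k hk
        have : 0 ≤ tPar μ r k - μ := by linarith
        have : 0 ≤ tPar μ r k - μ - 1 := by linarith
        positivity) h1 (by
        refine Summable.of_norm_bounded_eventually_nat (hG.mul_left β) ?_
        filter_upwards [hev] with k hk
        have ht0 := hp.tPar_pos k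
        have : 0 ≤ tPar μ r k - μ := by linarith
        have : 0 ≤ tPar μ r k - μ - 1 := by linarith
        rw [Real.norm_of_nonneg (by positivity), div_le_iff₀ ht0]
        calc β * ((tPar μ r k - μ) * (tPar μ r k - μ - 1)) * ‖G k‖ ^ 2
            ≤ β * (tPar μ r k * tPar μ r k) * ‖G k‖ ^ 2 := by
              gcongr <;> linarith
          _ = _ := by ring)
    have h3 : Tendsto (fun k : ℕ => (tPar μ r k * ‖G k‖) ^ 2) atTop (𝓝 0) := by
      have h4 := h2.const_mul (4 / β)
      rw [mul_zero] at h4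
      refine squeeze_zero' (Eventually.of_forall fun k => by positivity) ?_ h4
      filter_upwards [hev] with k hk
      have : (tPar μ r k) ^ 2 ≤ 4 * ((tPar μ r k - μ) * (tPar μ r k - μ - 1)) := by nlinarith
      calc (tPar μ r k * ‖G k‖) ^ 2 = tPar μ r k ^ 2 * ‖G k‖ ^ 2 := by ring
        _ ≤ 4 * ((tPar μ r k - μ) * (tPar μ r k - μ - 1)) * ‖G k‖ ^ 2 := by gcongr
        _ = _ := by field_simp
    have h5 := h3.sqrt
    rw [Real.sqrt_zero] at h5
    refine h5.congr fun k => Real.sqrt_sq ?_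
    have := (hp.tPar_pos k).le
    positivity
  refine ⟨hG, ?_, htG, ?_, fun w hw => ?_⟩
  · have hc : Summable fun k : ℕ => 2 * (‖s k - u k‖ ^ 2 / tPar μ r k)
        + 16 * β ^ 2 * (tPar μ r k * ‖G k‖ ^ 2 + tPar μ r k ^ 2 * ‖e k‖ ^ 2) :=
      (hz.mul_left 2).add ((hG.add he).mul_left _)
    refine Summable.of_nonneg_of_le (fun k => ?_) (fun k => ?_) hc
    · have := (hp.tPar_pos k).le
      positivity
    · have ht0 := hp.tPar_pos k
      have ht := hp.one_lt_tPar k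
      have h1 := increment_bound hp hs k
      have h2 := pow_le_pow_left₀ (by positivity) h1 2
      have h3 : tPar μ r k * ‖u (k + 1) - u k‖ ^ 2
          = (tPar μ r k * ‖u (k + 1) - u k‖) ^ 2 / tPar μ r k := by field_simp
      rw [h3, div_le_iff₀ ht0]
      refine h2.trans ?_
      have h4 : ‖s k - u k‖ ^ 2 / tPar μ r k * tPar μ r k = ‖s k - u k‖ ^ 2 := by field_simp
      have h5 : tPar μ r k ^ 2 * ‖e k‖ ^ 2 ≤ tPar μ r k ^ 2 * ‖e k‖ ^ 2 * tPar μ r k :=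
        le_mul_of_one_le_right (by positivity) (by linarith)
      have h6 := mul_le_mul_of_nonneg_left h5 (by positivity : 0 ≤ 16 * β ^ 2)
      rw [add_mul, mul_assoc 2 (‖s k - u k‖ ^ 2 / tPar μ r k), h4]
      set a := ‖s k - u k‖
      set b := tPar μ r k * ‖G k‖
      set c := tPar μ r k * ‖e k‖
      have h7 : tPar μ r k ^ 2 * ‖e k‖ ^ 2 = c ^ 2 := by ring
      have h8 : tPar μ r k * ‖G k‖ ^ 2 * tPar μ r k = b ^ 2 := by ring
      have h9 : (a + 2 * β * (b + c)) ^ 2 ≤ 2 * a ^ 2 + 16 * β ^ 2 * (b ^ 2 + c ^ 2) := by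
        nlinarith [sq_nonneg (a - 2 * β * (b + c)), sq_nonneg (β * (b - c))]
      rw [h7] at h6 ⊢
      linarith
  · have h1 : Tendsto (fun k : ℕ => ‖s k - u k‖
        + 2 * β * (tPar μ r k * ‖G k‖ + tPar μ r k * ‖e k‖)) atTop (𝓝 0) := by
      simpa using hz0.add ((htG.add hte).const_mul (2 * β))
    refine squeeze_zero (fun k => ?_) (fun k => increment_bound hp hs k) h1
    have := (hp.tPar_pos k).le
    positivity
  · obtain ⟨l, hl⟩ := hsw w hw
    have h1 : Tendsto (fun k => ‖s k - w‖) atTop (𝓝 (√l)) := by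
      refine hl.sqrt.congr fun k => Real.sqrt_sq (norm_nonneg _)
    refine ⟨√l, ?_⟩
    have h2 : Tendsto (fun k => ‖u k - w‖ - ‖s k - w‖) atTop (𝓝 0) := by
      refine squeeze_zero_norm (fun k => ?_) hz0
      rw [norm_sub_rev (s k) (u k)]
      have := abs_norm_sub_norm_le (u k - w) (s k - w)
      simpa using this
    simpa using h2.add h1

end Convergence

/-- Opial's lemma in a proper space. -/
lemma exists_tendsto_of_quasi_fejer {H : Type*} [NormedAddCommGroup H] [ProperSpace H] {Z : Set H} (hZ : Z.Nonempty) {u : ℕ → H}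
    (hu : ∀ w ∈ Z, ∃ l, Tendsto (fun k => ‖u k - w‖) atTop (𝓝 l))
    (hcl : ∀ (φ : ℕ → ℕ) (a : H), StrictMono φ → Tendsto (u ∘ φ) atTop (𝓝 a) → a ∈ Z) :
    ∃ a ∈ Z, Tendsto u atTop (𝓝 a) := by
  obtain ⟨w, hw⟩ := hZ
  obtain ⟨l, hl⟩ := hu w hw
  obtain ⟨R, hR⟩ := hl.bddAbove_range
  have hb : ∀ k, u k ∈ Metric.closedBall w R := fun k => by
    rw [mem_closedBall_iff_norm]
    exact hR ⟨k, rfl⟩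
  obtain ⟨a, -, φ, hφ, ha⟩ := (isCompact_closedBall w R).tendsto_subseq hb
  have haZ := hcl φ a hφ ha
  refine ⟨a, haZ, ?_⟩
  obtain ⟨l', hl'⟩ := hu a haZ
  have h1 : Tendsto (fun k => ‖u (φ k) - a‖) atTop (𝓝 l') := hl'.comp hφ.tendsto_atTop
  have h2 : Tendsto (fun k => ‖u (φ k) - a‖) atTop (𝓝 0) :=
    tendsto_iff_norm_sub_tendsto_zero.1 ha
  rw [tendsto_nhds_unique h1 h2] at hl'
  exact tendsto_iff_norm_sub_tendsto_zero.2 hl'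

/-! ### Co-coercivity of the residual and maximality of `T`. -/

section OperatorLemmas

variable {p : ℕ}

lemma norm_integral_sq_le_integral_norm_sq {E Ξ : Type*} [NormedAddCommGroup E]
    [InnerProductSpace ℝ E] [CompleteSpace E] {mΞ : MeasurableSpace Ξ} (P : Measure Ξ)
    [IsProbabilityMeasure P] {f : Ξ → E} (hf : Integrable f P)
    (hf2 : Integrable (fun ξ => ‖f ξ‖ ^ 2) P) :
    ‖∫ ξ, f ξ ∂P‖ ^ 2 ≤ ∫ ξ, ‖f ξ‖ ^ 2 ∂P := by
  set m := ∫ ξ, f ξ ∂P with hm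
  have h1 : ∫ ξ, (2 * ⟪m, f ξ⟫ - ‖m‖ ^ 2) ∂P ≤ ∫ ξ, ‖f ξ‖ ^ 2 ∂P := by
    refine integral_mono (((hf.const_inner m).const_mul 2).sub (integrable_const _)) hf2 fun ξ => ?_
    have := norm_sub_sq_real m (f ξ)
    dsimp only
    nlinarith [sq_nonneg ‖m - f ξ‖]
  rw [integral_sub ((hf.const_inner m).const_mul 2) (integrable_const _), integral_const_mul,
    integral_inner hf, ← hm, real_inner_self_eq_norm_sq] at h1
  simp only [integral_const, probReal_univ, one_smul] at h1
  linarith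

lemma Oracle.norm_sq_le_meanSqDiff {O : Oracle.{w} p} {F : Vec p → Vec p} (hO : O.Represents F)
    (hvar : O.BoundedVariance F) (x y : Vec p) : ‖F x - F y‖ ^ 2 ≤ O.meanSqDiff x y := by
  cases O with
  | finiteSum n Fi =>
    obtain ⟨hn, hF⟩ := hO
    have hn' : (0 : ℝ) < n := by exact_mod_cast hn
    simp only [Oracle.meanSqDiff]
    rw [hF, hF, ← smul_sub, ← Finset.sum_sub_distrib, norm_smul, mul_pow]
    have h1 : ‖∑ i, (Fi i x - Fi i y)‖ ^ 2 ≤ n * ∑ i, ‖Fi i x - Fi i y‖ ^ 2 := by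
      refine (pow_le_pow_left₀ (norm_nonneg _) (norm_sum_le _ _) 2).trans ?_
      simpa using sq_sum_le_card_mul_sum_sq (s := Finset.univ) (f := fun i => ‖Fi i x - Fi i y‖)
    rw [Real.norm_of_nonneg (by positivity)]
    calc (1 / (n : ℝ)) ^ 2 * ‖∑ i, (Fi i x - Fi i y)‖ ^ 2
        ≤ (1 / (n : ℝ)) ^ 2 * (n * ∑ i, ‖Fi i x - Fi i y‖ ^ 2) := by gcongr
      _ = _ := by field_simp
  | expectation Ξ mΞ P bF =>
    obtain ⟨hP, hF⟩ := hO
    obtain ⟨σ, -, hσ⟩ := hvar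
    -- Bounded variance makes the oracle differences square integrable, so that the integral in
    -- `meanSqDiff` is not the default value `0`.
    have hm : ∀ z, MemLp (fun ξ => bF z ξ - F z) 2 P := fun z =>
      (memLp_two_iff_integrable_sq_norm
        ((hF z).1.sub (integrable_const _)).aestronglyMeasurable).2 (hσ z).1
    have hm2 : MemLp (fun ξ => bF x ξ - bF y ξ) 2 P := by
      have h := ((hm x).sub (hm y)).add (memLp_const (F x - F y))
      refine h.ae_eq (Eventually.of_forall fun ξ => ?_)
      simp only [Pi.add_apply, Pi.sub_apply]
      abel
    have h2 := norm_integral_sq_le_integral_norm_sq P ((hF x).1.sub (hF y).1)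
      ((memLp_two_iff_integrable_sq_norm hm2.aestronglyMeasurable).1 hm2)
    rw [integral_sub' (hF x).1 (hF y).1, ← (hF x).2, ← (hF y).2] at h2
    exact h2

lemma lipschitz_of_cocoercive {F : Vec p → Vec p} {E : Vec p → Vec p → ℝ} {L : ℝ} (hL : 0 < L)
    (hF : ∀ x y, (1 / L) * E x y ≤ ⟪F x - F y, x - y⟫)
    (hE : ∀ x y, ‖F x - F y‖ ^ 2 ≤ E x y) : LipschitzWith L.toNNReal F := by
  refine LipschitzWith.of_dist_le_mul fun x y => ?_
  rw [dist_eq_norm, dist_eq_norm, Real.coe_toNNReal _ hL.le]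
  have h1 : (1 / L) * ‖F x - F y‖ ^ 2 ≤ ‖F x - F y‖ * ‖x - y‖ :=
    calc _ ≤ (1 / L) * E x y := by gcongr; exact hE x y
      _ ≤ _ := hF x y
      _ ≤ _ := real_inner_le_norm _ _
  have h2 : ‖F x - F y‖ ^ 2 ≤ L * (‖F x - F y‖ * ‖x - y‖) := by
    rwa [one_div, inv_mul_le_iff₀ hL] at h1
  rcases (norm_nonneg (F x - F y)).eq_or_lt with h | h
  · rw [← h]; positivity
  · refine le_of_mul_le_mul_left ?_ h
    linarith

/-- Adjoining the single point `(x, v)` to the graph keeps it co-hypomonotone, so maximality says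
the point was there already. -/
lemma MaximallyCoHypomonotone.mem_of_forall {ρ : ℝ} {T : Vec p → Set (Vec p)}
    (hT : MaximallyCoHypomonotone ρ T) {x v : Vec p}
    (h : ∀ y, ∀ w ∈ T y, -ρ * ‖v - w‖ ^ 2 ≤ ⟪v - w, x - y⟫) : v ∈ T x := by
  have h1 := hT.2 (fun y => {w | w ∈ T y ∨ (y = x ∧ w = v)}) ?_ (fun y w hw => Or.inl hw)
  · rw [← h1]; exact Or.inr ⟨rfl, rfl⟩
  · rintro y z a b (ha | ⟨rfl, rfl⟩) (hb | ⟨rfl, rfl⟩)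
    · exact hT.1 y z a b ha hb
    · have := h y a ha
      rw [← neg_sub a b, ← neg_sub y z, inner_neg_neg, norm_neg] at this
      exact this
    · exact h z b hb
    · simp

lemma MaximallyCoHypomonotone.closed_graph {ρ : ℝ} {T : Vec p → Set (Vec p)}
    (hT : MaximallyCoHypomonotone ρ T) {x v : ℕ → Vec p} {a b : Vec p} (hv : ∀ k, v k ∈ T (x k))
    (hx : Tendsto x atTop (𝓝 a)) (hb : Tendsto v atTop (𝓝 b)) : b ∈ T a := by
  refine hT.mem_of_forall fun y w hw => ?_
  refine le_of_tendsto_of_tendsto' (((hb.sub_const w).norm.pow 2).const_mul (-ρ))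
    ((hb.sub_const w).inner (hx.sub_const y)) fun k => hT.1 _ _ _ _ (hv k) hw

/-- Nonexpansiveness of the resolvent: in the expanded square, co-hypomonotonicity leaves a
remainder of at least `λ(λ - 2ρ)‖v - w‖² ≥ 0`. -/
lemma CoHypomonotone.norm_sub_le {ρ lam : ℝ} {T : Vec p → Set (Vec p)} (hT : CoHypomonotone ρ T)
    (hlam : 0 < lam) (hρ : 2 * ρ ≤ lam) {x y v w : Vec p} (hv : v ∈ T x) (hw : w ∈ T y) :
    ‖x - y‖ ≤ ‖(x + lam • v) - (y + lam • w)‖ := by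
  have h := hT x y v w hv hw
  have e : (x + lam • v) - (y + lam • w) = (x - y) + lam • (v - w) := by module
  have h2 : ‖(x - y) + lam • (v - w)‖ ^ 2 = ‖x - y‖ ^ 2 + 2 * lam * ⟪v - w, x - y⟫
      + lam ^ 2 * ‖v - w‖ ^ 2 := by
    rw [norm_add_sq_real, inner_smul_right, norm_smul, mul_pow, Real.norm_eq_abs, sq_abs,
      real_inner_comm]
    ring
  rw [e]
  refine le_of_sq_le_sq ?_ (norm_nonneg _)
  rw [h2]
  have h3 := mul_le_mul_of_nonneg_left h (by positivity : 0 ≤ 2 * lam)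
  have h4 : 0 ≤ lam * (lam - 2 * ρ) * ‖v - w‖ ^ 2 := by
    have : 0 ≤ lam - 2 * ρ := by linarith
    positivity
  linarith

/-- The residual of the backward-forward splitting is co-coercive. -/
lemma residual_cocoercive {ρ lam L Lhat : ℝ} {F : Vec p → Vec p} {E : Vec p → Vec p → ℝ}
    {T : Vec p → Set (Vec p)} (hT : CoHypomonotone ρ T) (hL : 0 < L) (hLL : L < Lhat)
    (hLρ : Lhat * ρ < 1) (hF : ∀ x y, (1 / L) * E x y ≤ ⟪F x - F y, x - y⟫)
    (hE : ∀ x y, ‖F x - F y‖ ^ 2 ≤ E x y) {x y v w : Vec p} (hv : v ∈ T x) (hw : w ∈ T y) :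
    lambdaConst L Lhat * E x y + betaBar lam Lhat ρ * ‖(F x + v) - (F y + w)‖ ^ 2
      ≤ ⟪(F x + v) - (F y + w), (x + lam • v) - (y + lam • w)⟫ := by
  have hLh : 0 < Lhat := hL.trans hLL
  have h1ρ : 0 < 1 - ρ * Lhat := by linarith
  have h1 := hF x y
  have h2 := hE x y
  have h3 := hT x y v w hv hw
  have e1 : (F x + v) - (F y + w) = (F x - F y) + (v - w) := by abel
  have e2 : (x + lam • v) - (y + lam • w) = (x - y) + lam • (v - w) := by module
  rw [e1, e2]
  generalize F x - F y = a at *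
  generalize v - w = b at *
  generalize x - y = d at *
  have h4 : 0 ≤ 1 / (4 * Lhat * (1 - ρ * Lhat))
      * ‖(2 - Lhat * lam) • a - (Lhat * (lam - 2 * ρ)) • b‖ ^ 2 := by positivity
  rw [norm_sub_sq_real, norm_smul, norm_smul, mul_pow, mul_pow, Real.norm_eq_abs, Real.norm_eq_abs,
    sq_abs, sq_abs, inner_smul_left, inner_smul_right, conj_trivial] at h4
  -- Since `Λ = 1/L - 1/L̂`, the share `Λ E` is reserved for the variance recursion and `E/L̂ ≥
  -- ‖a‖²/L̂` goes into the quadratic form.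
  have h5 : 1 / L * E x y = lambdaConst L Lhat * E x y + 1 / Lhat * E x y := by
    unfold lambdaConst; field_simp; ring
  have h6 : 1 / Lhat * ‖a‖ ^ 2 ≤ 1 / Lhat * E x y := by gcongr
  -- `betaBar` is the value at which the remaining form in `a` and `b` degenerates to a perfect
  -- square.
  have h7 : 1 / (4 * Lhat * (1 - ρ * Lhat)) * ((2 - Lhat * lam) ^ 2 * ‖a‖ ^ 2
      - 2 * ((2 - Lhat * lam) * (Lhat * (lam - 2 * ρ) * ⟪a, b⟫))
      + (Lhat * (lam - 2 * ρ)) ^ 2 * ‖b‖ ^ 2)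
      = 1 / Lhat * ‖a‖ ^ 2 + lam * ⟪a, b⟫ + (lam - ρ) * ‖b‖ ^ 2
        - betaBar lam Lhat ρ * (‖a‖ ^ 2 + 2 * ⟪a, b⟫ + ‖b‖ ^ 2) := by
    have hne : 1 - Lhat * ρ ≠ 0 := by rw [mul_comm]; exact h1ρ.ne'
    unfold betaBar
    field_simp
    ring
  rw [h7] at h4
  rw [norm_add_sq_real, inner_add_left, inner_add_right, inner_add_right, inner_smul_right,
    inner_smul_right, real_inner_self_eq_norm_sq]
  linarith

end OperatorLemmas

/-! ### Expected descent and almost sure summability. -/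

section Stochastic

variable {Ω : Type*} {mΩ : MeasurableSpace Ω} {Pr : Measure Ω} [IsProbabilityMeasure Pr]
  {ℱ : Filtration ℕ mΩ}

/-- One step of the expected decrease of a Lyapunov function on an event known at time `k`. -/
lemma setLIntegral_lyapunov_step {k : ℕ} {V X W err Δ : Ω → ℝ} {a b d g τ : ℝ}
    (hVm : Measurable[ℱ k] V) (herrm : Measurable err)
    (hV : ∀ ω, 0 ≤ V ω) (hX : ∀ ω, 0 ≤ X ω)
    (herr : ∀ ω, 0 ≤ err ω) (hΔ : ∀ ω, 0 ≤ Δ ω)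
    (hb : 0 ≤ b) (hd : 0 ≤ d) (hg : 0 ≤ g) (hτ : 0 ≤ τ) (ha : b + g + d ≤ a)
    (hstep : ∀ ω, W ω ≤ V ω + b * err ω + g * Δ ω)
    (h₁ : ∀ᵐ ω ∂Pr, condLExp (ℱ k) Pr (fun ω => ENNReal.ofReal (err ω)) ω
      ≤ condLExp (ℱ k) Pr (fun ω => ENNReal.ofReal (Δ ω)) ω)
    (h₂ : ∀ᵐ ω ∂Pr, ENNReal.ofReal a * condLExp (ℱ k) Pr (fun ω => ENNReal.ofReal (Δ ω)) ω
      ≤ ENNReal.ofReal (X ω + τ))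
    {A : Set Ω} (hA : MeasurableSet[ℱ k] A) :
    ∫⁻ ω in A, ENNReal.ofReal (W ω) ∂Pr
        + ENNReal.ofReal d * ∫⁻ ω in A, ENNReal.ofReal (err ω) ∂Pr
      ≤ ∫⁻ ω in A, ENNReal.ofReal (V ω + X ω) ∂Pr + ENNReal.ofReal τ := by
  have hVm' : Measurable V := hVm.mono (ℱ.le k) le_rfl
  set J := ∫⁻ ω in A, ENNReal.ofReal (Δ ω) ∂Pr with hJ
  have herrJ : ∫⁻ ω in A, ENNReal.ofReal (err ω) ∂Pr ≤ J := by
    calc _ = _ := (setLIntegral_condLExp (ℱ.le k) Pr _ hA).symm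
      _ ≤ _ := lintegral_mono_ae (ae_restrict_of_ae h₁)
      _ = _ := setLIntegral_condLExp (ℱ.le k) Pr _ hA
  have hW : ∫⁻ ω in A, ENNReal.ofReal (W ω) ∂Pr ≤ ∫⁻ ω in A, ENNReal.ofReal (V ω) ∂Pr
      + ENNReal.ofReal b * J + ENNReal.ofReal g * J := by
    calc ∫⁻ ω in A, ENNReal.ofReal (W ω) ∂Pr
        ≤ ∫⁻ ω in A, (ENNReal.ofReal (V ω) + ENNReal.ofReal b * ENNReal.ofReal (err ω)
            + ENNReal.ofReal g * ENNReal.ofReal (Δ ω)) ∂Pr := by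
          refine lintegral_mono fun ω => ?_
          rw [← ENNReal.ofReal_mul hb, ← ENNReal.ofReal_mul hg,
            ← ENNReal.ofReal_add (hV ω) (mul_nonneg hb (herr ω)),
            ← ENNReal.ofReal_add (add_nonneg (hV ω) (mul_nonneg hb (herr ω)))
              (mul_nonneg hg (hΔ ω))]
          exact ENNReal.ofReal_le_ofReal (hstep ω)
      _ = ∫⁻ ω in A, ENNReal.ofReal (V ω) ∂Pr
            + ENNReal.ofReal b * ∫⁻ ω in A, ENNReal.ofReal (err ω) ∂Pr + ENNReal.ofReal g * J := by
          rw [lintegral_add_left (by fun_prop), lintegral_add_left (by fun_prop),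
            lintegral_const_mul' _ _ ENNReal.ofReal_ne_top,
            lintegral_const_mul' _ _ ENNReal.ofReal_ne_top]
      _ ≤ _ := by gcongr
  -- The error integral is at most `J`, so `(b + g + d) J` covers the Lyapunov step, the
  -- carried-over `Δ` and the extracted error; this inequality pays for it.
  have haJ : ENNReal.ofReal a * J ≤ ∫⁻ ω in A, ENNReal.ofReal (X ω) ∂Pr + ENNReal.ofReal τ := by
    calc ENNReal.ofReal a * J
        = ∫⁻ ω in A, ENNReal.ofReal a
            * condLExp (ℱ k) Pr (fun ω => ENNReal.ofReal (Δ ω)) ω ∂Pr := by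
          rw [lintegral_const_mul' _ _ ENNReal.ofReal_ne_top,
            setLIntegral_condLExp (ℱ.le k) Pr _ hA]
      _ ≤ ∫⁻ ω in A, (ENNReal.ofReal (X ω) + ENNReal.ofReal τ) ∂Pr := by
          refine lintegral_mono_ae (ae_restrict_of_ae ?_)
          filter_upwards [h₂] with ω hω
          rwa [← ENNReal.ofReal_add (hX ω) hτ]
      _ = ∫⁻ ω in A, ENNReal.ofReal (X ω) ∂Pr + ENNReal.ofReal τ * Pr A := by
          rw [lintegral_add_right _ measurable_const, setLIntegral_const]
      _ ≤ _ := by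
          gcongr
          exact mul_le_of_le_one_right' prob_le_one
  calc ∫⁻ ω in A, ENNReal.ofReal (W ω) ∂Pr
        + ENNReal.ofReal d * ∫⁻ ω in A, ENNReal.ofReal (err ω) ∂Pr
      ≤ (∫⁻ ω in A, ENNReal.ofReal (V ω) ∂Pr + ENNReal.ofReal b * J + ENNReal.ofReal g * J)
        + ENNReal.ofReal d * J := by gcongr
    _ = ∫⁻ ω in A, ENNReal.ofReal (V ω) ∂Pr + ENNReal.ofReal (b + g + d) * J := by
        rw [ENNReal.ofReal_add (by positivity) hd, ENNReal.ofReal_add hb hg]; ring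
    _ ≤ ∫⁻ ω in A, ENNReal.ofReal (V ω) ∂Pr + ENNReal.ofReal a * J := by gcongr
    _ ≤ ∫⁻ ω in A, ENNReal.ofReal (V ω) ∂Pr
        + (∫⁻ ω in A, ENNReal.ofReal (X ω) ∂Pr + ENNReal.ofReal τ) := by gcongr
    _ = _ := by
        rw [← add_assoc, ← lintegral_add_left (by fun_prop)]
        congr 1
        exact lintegral_congr fun ω => (ENNReal.ofReal_add (hV ω) (hX ω)).symm

/-- Almost sure summability of the weighted errors of a variance-reduced estimator, from a
Lyapunov function `V` and the variance-reduction residual `X`. No integrability is required at the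
initial time. -/
theorem ae_summable_error_of_lyapunov {K : ℕ} {V X err Δ : ℕ → Ω → ℝ} {a b d g τ : ℕ → ℝ}
    (hVm : ∀ k, Measurable[ℱ k] (V k)) (hXm : ∀ k, Measurable[ℱ k] (X k))
    (herrm : ∀ k, Measurable (err k))
    (hV : ∀ k ≥ K, ∀ ω, 0 ≤ V k ω) (hX : ∀ k ≥ K, ∀ ω, 0 ≤ X k ω)
    (herr : ∀ k ω, 0 ≤ err k ω) (hΔ : ∀ k ω, 0 ≤ Δ k ω)
    (hb : ∀ k, 0 ≤ b k) (hd : ∀ k, 0 ≤ d k) (hg : ∀ k, 0 ≤ g k) (hτ : ∀ k, 0 ≤ τ k)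
    (ha : ∀ k, b k + g k + d k ≤ a k) (hτs : Summable τ)
    (hstep : ∀ k ≥ K, ∀ ω, V (k + 1) ω + X (k + 1) ω ≤ V k ω + b k * err k ω + g k * Δ k ω)
    (h₁ : ∀ k, ∀ᵐ ω ∂Pr, condLExp (ℱ k) Pr (fun ω => ENNReal.ofReal (err k ω)) ω
      ≤ condLExp (ℱ k) Pr (fun ω => ENNReal.ofReal (Δ k ω)) ω)
    (h₂ : ∀ k ≥ K, ∀ᵐ ω ∂Pr,
      ENNReal.ofReal (a k) * condLExp (ℱ k) Pr (fun ω => ENNReal.ofReal (Δ k ω)) ω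
        ≤ ENNReal.ofReal (X k ω + τ k)) :
    ∀ᵐ ω ∂Pr, Summable fun k => d k * err k ω := by
  -- These events are known at time `K`, hence at every later time, and they exhaust `Ω`. On each of
  -- them the starting integral is at most `N`.
  set A : ℕ → Set Ω := fun N => {ω | V K ω + X K ω ≤ N}
  have hA : ∀ N k, MeasurableSet[ℱ (K + k)] (A N) := fun N k =>
    ℱ.mono (Nat.le_add_right K k) _
      (((hVm K).add (hXm K)) measurableSet_Iic)
  have key : ∀ N : ℕ, ∀ᵐ ω ∂Pr, ω ∈ A N → Summable fun k => d (K + k) * err (K + k) ω := by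
    intro N
    have hAm : MeasurableSet (A N) := ℱ.le _ _ (hA N 0)
    rw [← ae_restrict_iff' hAm]
    set I : ℕ → ℝ≥0∞ := fun k => ∫⁻ ω in A N, ENNReal.ofReal (V (K + k) ω + X (K + k) ω) ∂Pr
    set Q : ℕ → ℝ≥0∞ := fun k =>
      ENNReal.ofReal (d (K + k)) * ∫⁻ ω in A N, ENNReal.ofReal (err (K + k) ω) ∂Pr
    have hI : ∀ k, I (k + 1) + Q k ≤ I k + ENNReal.ofReal (τ (K + k)) := fun k =>
      setLIntegral_lyapunov_step (hVm _) (herrm _) (hV _ (Nat.le_add_right K k)) (hX _ (Nat.le_add_right K k))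
        (herr _) (hΔ _) (hb _) (hd _) (hg _) (hτ _) (ha _) (hstep _ (Nat.le_add_right K k)) (h₁ _)
        (h₂ _ (Nat.le_add_right K k)) (hA N k)
    have hI0 : I 0 ≤ N := by
      calc I 0 ≤ ∫⁻ _ in A N, (N : ℝ≥0∞) ∂Pr := by
            refine setLIntegral_mono measurable_const fun ω hω => ?_
            rw [← ENNReal.ofReal_natCast]
            exact ENNReal.ofReal_le_ofReal hω
        _ = N * Pr (A N) := setLIntegral_const _ _
        _ ≤ N := mul_le_of_le_one_right' prob_le_one
    have hsum : ∀ n, I n + ∑ k ∈ Finset.range n, Q k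
        ≤ I 0 + ∑ k ∈ Finset.range n, ENNReal.ofReal (τ (K + k)) := by
      intro n
      induction n with
      | zero => simp
      | succ n ih =>
        rw [Finset.sum_range_succ, Finset.sum_range_succ]
        calc I (n + 1) + (∑ k ∈ Finset.range n, Q k + Q n)
            = (I (n + 1) + Q n) + ∑ k ∈ Finset.range n, Q k := by ring
          _ ≤ (I n + ENNReal.ofReal (τ (K + n))) + ∑ k ∈ Finset.range n, Q k := by
              exact add_le_add_left (hI n) _
          _ = (I n + ∑ k ∈ Finset.range n, Q k) + ENNReal.ofReal (τ (K + n)) := by ring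
          _ ≤ _ := by rw [← add_assoc]; gcongr
    have hτs' : Summable fun k => τ (K + k) := by
      simpa only [add_comm K] using (summable_nat_add_iff K).2 hτs
    have hQ : ∑' k, Q k ≤ N + ENNReal.ofReal (∑' k, τ (K + k)) := by
      refine ENNReal.tsum_le_of_sum_range_le fun n => ?_
      calc ∑ k ∈ Finset.range n, Q k ≤ I n + ∑ k ∈ Finset.range n, Q k := le_add_self
        _ ≤ _ := hsum n
        _ ≤ _ := by
          gcongr
          rw [← ENNReal.ofReal_sum_of_nonneg fun k _ => hτ _]
          exact ENNReal.ofReal_le_ofReal (hτs'.sum_le_tsum _ fun k _ => hτ _)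
    have hint : ∫⁻ ω in A N, ∑' k, ENNReal.ofReal (d (K + k) * err (K + k) ω) ∂Pr ≠ ∞ := by
      rw [lintegral_tsum fun k => by have := herrm (K + k); fun_prop]
      refine ne_top_of_le_ne_top (by simp) (le_trans (le_of_eq ?_) hQ)
      congr 1
      ext k
      refine Eq.trans ?_ (lintegral_const_mul' _ _ ENNReal.ofReal_ne_top)
      exact lintegral_congr fun ω => ENNReal.ofReal_mul (hd _)
    have hfin := ae_lt_top' (by
      have := fun k => herrm (K + k)
      exact (Measurable.tsum fun k => by have := this k; fun_prop).aemeasurable) hint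
    filter_upwards [hfin] with ω hω
    refine (ENNReal.summable_toReal hω.ne).congr fun k => ?_
    exact ENNReal.toReal_ofReal (mul_nonneg (hd _) (herr _ _))
  filter_upwards [ae_all_iff.2 key] with ω hω
  obtain ⟨N, hN⟩ := exists_nat_ge (V K ω + X K ω)
  rw [← summable_nat_add_iff K]
  simpa only [add_comm K] using hω N hN

end Stochastic

/-! ### The algorithm as an accelerated scheme, and its cluster points. -/

section Algorithm

variable {p : ℕ}

/-- The pairs `(u, x)` with `x ∈ J_{λT} u` and `F x + (u - x) / λ = 0`. -/
def zeroPairs (F : Vec p → Vec p) (T : Vec p → Set (Vec p)) (lam : ℝ) : Set (Vec p × Vec p) :=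
  {q | ∃ v ∈ T q.2, q.1 = q.2 + lam • v ∧ F q.2 + v = 0}

lemma zeroPairs_nonempty {F : Vec p → Vec p} {T : Vec p → Set (Vec p)} {lam : ℝ}
    (hzer : (zer (sumOp F T)).Nonempty) : (zeroPairs F T lam).Nonempty := by
  obtain ⟨x, v, hv, h⟩ := hzer
  exact ⟨(x + lam • v, x), v, hv, rfl, h.symm⟩

section

variable {ρ lam L Lhat : ℝ} {F : Vec p → Vec p} {E : Vec p → Vec p → ℝ} {T : Vec p → Set (Vec p)}

lemma residual_inner_nonneg (hT : CoHypomonotone ρ T) (hL : 0 < L) (hLL : L < Lhat)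
    (hLρ : Lhat * ρ < 1) (hF : ∀ x y, (1 / L) * E x y ≤ ⟪F x - F y, x - y⟫)
    (hE : ∀ x y, ‖F x - F y‖ ^ 2 ≤ E x y) (hb : 0 ≤ betaBar lam Lhat ρ) {x v : Vec p}
    (hv : v ∈ T x) {q : Vec p × Vec p} (hq : q ∈ zeroPairs F T lam) :
    0 ≤ ⟪F x + v, (x + lam • v) - q.1⟫ := by
  obtain ⟨w, hw, h1, h2⟩ := hq
  have h := residual_cocoercive (lam := lam) hT hL hLL hLρ hF hE hv hw
  rw [h2, sub_zero, ← h1] at h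
  have hΛ : 0 ≤ lambdaConst L Lhat := div_nonneg (by linarith) (by nlinarith)
  have hE0 : 0 ≤ E x q.2 := (sq_nonneg _).trans (hE x q.2)
  refine le_trans ?_ h
  positivity

/-- Nonexpansiveness makes `x` Cauchy along any subsequence on which `u` converges, so `v` converges
too and the closed graph of `T` applies. The resolvent need not be known to be defined everywhere.
-/
lemma zeroPairs_of_tendsto (hT : MaximallyCoHypomonotone ρ T) (hFc : Continuous F)
    (hlam : 0 < lam) (hρ : 2 * ρ ≤ lam) {u x v : ℕ → Vec p} (hv : ∀ k, v k ∈ T (x k))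
    (hu : ∀ k, u k = x k + lam • v k) (hG : Tendsto (fun k => F (x k) + v k) atTop (𝓝 0))
    {φ : ℕ → ℕ} {a : Vec p} (hφ : StrictMono φ) (ha : Tendsto (u ∘ φ) atTop (𝓝 a)) :
    a ∈ Prod.fst '' zeroPairs F T lam := by
  have hne : ∀ i j, ‖x i - x j‖ ≤ ‖u i - u j‖ := fun i j => by
    rw [hu, hu]; exact hT.1.norm_sub_le hlam hρ (hv i) (hv j)
  have hcx : CauchySeq (x ∘ φ) := by
    have hcu := ha.cauchySeq
    rw [Metric.cauchySeq_iff] at hcu ⊢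
    intro ε hε
    obtain ⟨N, hN⟩ := hcu ε hε
    refine ⟨N, fun m hm n hn => lt_of_le_of_lt ?_ (hN m hm n hn)⟩
    rw [dist_eq_norm, dist_eq_norm]
    exact hne _ _
  obtain ⟨y, hy⟩ := cauchySeq_tendsto_of_complete hcx
  have hve : ∀ k, v k = lam⁻¹ • (u k - x k) := fun k => by
    rw [hu, add_sub_cancel_left, inv_smul_smul₀ hlam.ne']
  have hvl : Tendsto (v ∘ φ) atTop (𝓝 (lam⁻¹ • (a - y))) :=
    ((ha.sub hy).const_smul lam⁻¹).congr fun k => (hve _).symm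
  refine ⟨(a, y), ⟨lam⁻¹ • (a - y), hT.closed_graph (fun k => hv (φ k)) hy hvl, ?_, ?_⟩, rfl⟩
  · rw [smul_inv_smul₀ hlam.ne']; abel
  · exact tendsto_nhds_unique (((hFc.tendsto y).comp hy).add hvl) (hG.comp hφ.tendsto_atTop)

end

variable {Ω : Type*} {T : Vec p → Set (Vec p)} {lam ν : ℝ} {t η : ℤ → ℝ}
  {x u s v ξ Ft : ℕ → Ω → Vec p}

lemma IsVFOSAMinus.xi_mem_and_u_eq (h : IsVFOSAMinus T lam ν t η x u s v ξ Ft) (hlam : 0 < lam)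
    (k : ℕ) (ω : Ω) : ξ k ω ∈ T (x k ω) ∧ u k ω = x k ω + lam • ξ k ω := by
  obtain ⟨w, hw, hu⟩ := h.shadow k ω
  have : ξ k ω = w := by
    rw [h.xi_eq, hu, add_sub_cancel_left, inv_smul_smul₀ hlam.ne']
  rw [this]
  exact ⟨hw, hu⟩

lemma IsVFOSAMinus.accelScheme {F : Vec p → Vec p} {β βbar μ r : ℝ} (hp : AccelParams β βbar μ r)
    (h : IsVFOSAMinus T lam (μ / 2) (tPar μ r) (etaPar μ r (μ / 2) β) x u s v ξ Ft) (ω : Ω)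
    (hG : ∀ k, βbar * ‖(F (x (k + 1) ω) + ξ (k + 1) ω) - (F (x k ω) + ξ k ω)‖ ^ 2
      ≤ ⟪(F (x (k + 1) ω) + ξ (k + 1) ω) - (F (x k ω) + ξ k ω), u (k + 1) ω - u k ω⟫) :
    AccelScheme β βbar μ r (fun k => F (x k ω) + ξ k ω) (fun k => Ft k ω - F (x k ω))
      (fun k => u k ω) (fun k => s k ω) := by
  have hv : ∀ k : ℕ, v k ω = u k ω + (tPar μ r k)⁻¹ • (s k ω - u k ω) := fun k => by
    have := (hp.tPar_pos k).ne'
    rw [h.v_eq, show (tPar μ r k - 1) / tPar μ r k = 1 - (tPar μ r k)⁻¹ by field_simp, one_div]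
    module
  have hGe : ∀ k : ℕ, Ft k ω + lam⁻¹ • (u k ω - x k ω)
      = (F (x k ω) + ξ k ω) + (Ft k ω - F (x k ω)) := fun k => by
    rw [← h.xi_eq]; abel
  refine ⟨fun k => ?_, fun k => ?_, hG⟩
  · rw [h.u_succ, hv, hGe]
  · rw [h.s_succ, h.u_succ, hGe]
    module

lemma IsVFOSAMinus.measurable {mΩ : MeasurableSpace Ω} {ℱ : Filtration ℕ mΩ}
    (h : IsVFOSAMinus T lam ν t η x u s v ξ Ft) (hu0 : Measurable[ℱ 0] (u 0))
    (hx : ∀ k, Measurable[ℱ k] (x k)) (hFt : ∀ k, Measurable[ℱ (k + 1)] (Ft k)) (k : ℕ) :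
    Measurable[ℱ k] (u k) ∧ Measurable[ℱ k] (s k) ∧ Measurable[ℱ k] (ξ k) := by
  have hus : Measurable[ℱ k] (u k) ∧ Measurable[ℱ k] (s k) := by
    induction k with
    | zero => exact ⟨hu0, by rwa [funext h.init_s]⟩
    | succ k ih =>
      have hle : ℱ k ≤ ℱ (k + 1) := ℱ.mono (Nat.le_succ k)
      have hu' := ih.1.mono hle le_rfl
      have hs' := ih.2.mono hle le_rfl
      have hx' := (hx k).mono hle le_rfl
      have hv' : Measurable[ℱ (k + 1)] (v k) := by
        rw [show v k = ((t k - 1) / t k) • u k + (1 / t k) • s k from funext (h.v_eq k)]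
        exact (hu'.const_smul _).add (hs'.const_smul _)
      have hu1 : Measurable[ℱ (k + 1)] (u (k + 1)) := by
        rw [show u (k + 1) = v k - η k • (Ft k + lam⁻¹ • (u k - x k)) from funext (h.u_succ k)]
        exact hv'.sub (((hFt k).add ((hu'.sub hx').const_smul _)).const_smul _)
      refine ⟨hu1, ?_⟩
      rw [show s (k + 1) = s k + ν • (u (k + 1) - v k) from funext (h.s_succ k)]
      exact hs'.add ((hu1.sub hv').const_smul _)
  refine ⟨hus.1, hus.2, ?_⟩
  rw [show ξ k = lam⁻¹ • (u k - x k) from funext (h.xi_eq k)]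
  exact (hus.1.sub (hx k)).const_smul _

end Algorithm

/-! ### Summability of the estimator errors. -/

section Errors

variable {p : ℕ} {Ω : Type*} {mΩ : MeasurableSpace Ω} {Pr : Measure Ω} [IsProbabilityMeasure Pr]
  {ℱ : Filtration ℕ mΩ}

lemma measurable_lyapSeq {m : MeasurableSpace Ω} {β μ r : ℝ} {G u s : ℕ → Ω → Vec p} {w : Vec p}
    {k : ℕ} (hG : Measurable (G k)) (hu : Measurable (u k)) (hs : Measurable (s k)) :
    Measurable fun ω => lyapSeq β μ r (fun j => G j ω) (fun j => u j ω) (fun j => s j ω) w k := by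
  unfold lyapSeq lyap
  fun_prop

lemma measurable_cocoercive_gap {m : MeasurableSpace Ω} {b : ℝ} {G G' u u' : Ω → Vec p}
    (hG : Measurable G) (hG' : Measurable G') (hu : Measurable u) (hu' : Measurable u') :
    Measurable fun ω => ⟪G ω - G' ω, u ω - u' ω⟫ - b * ‖G ω - G' ω‖ ^ 2 := by
  fun_prop

/-- The weighted errors of the variance-reduced estimator are almost surely summable. -/
theorem VREstimator.ae_summable_error {O : Oracle.{w} p} {F : Vec p → Vec p} (hFc : Continuous F)
    {β βbar Λ μ r : ℝ} (hp : AccelParams β βbar μ r)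
    {x u s ξ Ft : ℕ → Ω → Vec p} {Δ : ℕ → Ω → ℝ} {κ Θ σ Γ : ℕ → ℝ}
    (hVR : VREstimator Pr ℱ O F x Ft Δ κ Θ σ)
    (hum : ∀ k, Measurable[ℱ k] (u k)) (hsm : ∀ k, Measurable[ℱ k] (s k))
    (hξm : ∀ k, Measurable[ℱ k] (ξ k))
    (hE : ∀ y z, 0 ≤ O.meanSqDiff y z)
    (hco : ∀ k ω, Λ * O.meanSqDiff (x (k + 1) ω) (x k ω)
        + βbar * ‖(F (x (k + 1) ω) + ξ (k + 1) ω) - (F (x k ω) + ξ k ω)‖ ^ 2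
      ≤ ⟪(F (x (k + 1) ω) + ξ (k + 1) ω) - (F (x k ω) + ξ k ω), u (k + 1) ω - u k ω⟫)
    (hsch : ∀ ω, AccelScheme β βbar μ r (fun k => F (x k ω) + ξ k ω)
      (fun k => Ft k ω - F (x k ω)) (fun k => u k ω) (fun k => s k ω))
    {w : Vec p} (hw : ∀ k ω, 0 ≤ ⟪F (x k ω) + ξ k ω, u k ω - w⟫)
    (hκ : ∀ k : ℕ, 1 - Γ k * (tPar μ r (k - 1) * (tPar μ r (k - 1) - 1))
        / (Γ (k + 1) * (tPar μ r k * (tPar μ r k - 1))) + 5 * β / (μ * Γ (k + 1)) ≤ κ (k + 1))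
    (hΓ : ∀ k, 0 < Γ k) (hΘ : ∀ k, 0 < Θ k) (hΛ : 0 ≤ Λ) (hΓΘ : ∀ k, Γ k * Θ k ≤ Λ)
    (hB : Summable fun k : ℕ => Λ / β
        * (tPar μ r (k - 1) * (tPar μ r (k - 1) - 1) * (σ k ^ 2 / Θ k))) :
    ∀ᵐ ω ∂Pr, Summable fun k : ℕ => tPar μ r k ^ 2 * ‖Ft k ω - F (x k ω)‖ ^ 2 := by
  obtain ⟨ε, hε, K, hK⟩ := exists_lyapSeq_step (H := Vec p) hp
  have hμ := hp.mu_pos; have hμ2 := hp.mu_lt; have hβ := hp.beta_pos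
  -- The subtraction takes place in `ℤ`, so `c 0` involves the true `t_{-1}`, which is at least `1 +
  -- μ`.
  set c : ℕ → ℝ := fun k => tPar μ r (k - 1) * (tPar μ r (k - 1) - 1) with hc
  have hcs : ∀ k, c (k + 1) = tPar μ r k * (tPar μ r k - 1) := fun k => by
    simp only [hc]
    push_cast
    rw [add_sub_cancel_right]
  have hc0 : ∀ k, 0 < c k := fun k => by
    have := hp.one_lt_tPar k
    simp only [hc]
    rw [tPar_sub_one]
    apply mul_pos <;> linarith
  have hκ0 : ∀ k, 0 ≤ 1 - κ k := fun k => by linarith [hVR.kappa_le_one k]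
  set G : ℕ → Ω → Vec p := fun k ω => F (x k ω) + ξ k ω with hGdef
  have hGm : ∀ k, Measurable[ℱ k] (G k) := fun k =>
    (hFc.measurable.comp (hVR.measurable_iterate k)).add (hξm k)
  set Dh : ℕ → Ω → ℝ := fun k ω => ⟪G k ω - G (k - 1) ω, u k ω - u (k - 1) ω⟫
    - βbar * ‖G k ω - G (k - 1) ω‖ ^ 2 with hDh
  have hDhm : ∀ k, Measurable[ℱ k] (Dh k) := fun k => by
    have hle : ℱ (k - 1) ≤ ℱ k := ℱ.mono (Nat.sub_le k 1)
    have h1 := hGm k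
    have h2 := (hGm (k - 1)).mono hle le_rfl
    have h3 := hum k
    have h4 := (hum (k - 1)).mono hle le_rfl
    exact measurable_cocoercive_gap h1 h2 h3 h4
  have hDhE : ∀ k ≥ 1, ∀ ω, Λ * O.meanSqDiff (x k ω) (x (k - 1) ω) ≤ Dh k ω := by
    intro k hk ω
    obtain ⟨j, rfl⟩ : ∃ j, k = j + 1 := ⟨k - 1, by omega⟩
    have := hco j ω
    simp only [hDh, Nat.add_sub_cancel, hGdef]
    linarith
  have hDh0 : ∀ k ≥ 1, ∀ ω, 0 ≤ Dh k ω := fun k hk ω =>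
    le_trans (mul_nonneg hΛ (hE _ _)) (hDhE k hk ω)
  set Δ' : ℕ → Ω → ℝ := fun k ω => if k = 0 then 0 else Δ (k - 1) ω with hΔ'
  have hΔ'0 : ∀ k ω, 0 ≤ Δ' k ω := fun k ω => by
    simp only [hΔ']; split_ifs
    · exact le_rfl
    · exact hVR.delta_nonneg _ _
  have hΔ'm : ∀ k, Measurable[ℱ k] (Δ' k) := fun k => by
    rcases k with _ | k
    · simp only [hΔ', if_true]; exact measurable_const
    · simpa [hΔ'] using hVR.measurable_delta k
  -- The variance recursion is multiplied by `Γ k * c k`; since `Γ Θ ≤ Λ`, its term in `𝓔` is then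
  -- bounded by `c k` times the gap `Dh k`, which the previous Lyapunov step released. Starting at
  -- `K + 1` keeps `k - 1` a genuine predecessor.
  have hsum := ae_summable_error_of_lyapunov (Pr := Pr) (ℱ := ℱ) (K := K + 1)
    (V := fun k ω => lyapSeq β μ r (fun j => G j ω) (fun j => u j ω) (fun j => s j ω) w k)
    (X := fun k ω => Γ k * c k * (1 - κ k) * Δ' k ω + c k * Dh k ω)
    (err := fun k ω => ‖Ft k ω - F (x k ω)‖ ^ 2) (Δ := Δ)
    (a := fun k => Γ k * c k) (b := fun k => 4 * β / μ * c (k + 1))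
    (d := fun k => β / μ * c (k + 1)) (g := fun k => Γ (k + 1) * c (k + 1) * (1 - κ (k + 1)))
    (τ := fun k => Γ k * c k * σ k ^ 2)
    (fun k => measurable_lyapSeq (hGm k) (hum k) (hsm k))
    (fun k => ((hΔ'm k).const_mul _).add ((hDhm k).const_mul _))
    (fun k => by
      have h1 := (hVR.measurable_estimator k).mono (ℱ.le _) le_rfl
      have h2 := hFc.measurable.comp ((hVR.measurable_iterate k).mono (ℱ.le _) le_rfl)
      exact (h1.sub h2).norm.pow_const 2)
    (fun k hk ω => le_trans (by positivity)
      (hK _ _ _ _ (hsch ω) w k (by omega) (hw k ω)).1)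
    (fun k hk ω => add_nonneg
      (mul_nonneg (mul_nonneg (mul_nonneg (hΓ k).le (hc0 k).le) (hκ0 k)) (hΔ'0 k ω))
      (mul_nonneg (hc0 k).le (hDh0 k (by omega) ω)))
    (fun k ω => by positivity) hVR.delta_nonneg
    (fun k => by have := (hc0 (k + 1)).le; positivity)
    (fun k => by have := (hc0 (k + 1)).le; positivity)
    (fun k => mul_nonneg (mul_nonneg (hΓ _).le (hc0 _).le) (hκ0 _))
    (fun k => mul_nonneg (mul_nonneg (hΓ _).le (hc0 _).le) (sq_nonneg _))
    (fun k => by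
      -- The constant `5β/μ` splits into `4β/μ`, the cost of the Lyapunov step, and `β/μ`, the
      -- weight with which errors are summed.
      have h1 := hκ k
      rw [← hcs] at h1
      have hG1 := hΓ (k + 1)
      have hc1 := hc0 (k + 1)
      have h2 : 1 - κ (k + 1) ≤ Γ k * c k / (Γ (k + 1) * c (k + 1)) - 5 * β / (μ * Γ (k + 1)) := by
        linarith
      have h3 := mul_le_mul_of_nonneg_left h2 (mul_pos hG1 hc1).le
      have h4 : Γ (k + 1) * c (k + 1) * (Γ k * c k / (Γ (k + 1) * c (k + 1))
          - 5 * β / (μ * Γ (k + 1))) = Γ k * c k - 5 * β / μ * c (k + 1) := by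
        field_simp
      rw [h4] at h3
      have h5 : 5 * β / μ * c (k + 1) = 4 * β / μ * c (k + 1) + β / μ * c (k + 1) := by ring
      linarith)
    (by
      refine Summable.of_nonneg_of_le
        (fun k => mul_nonneg (mul_nonneg (hΓ _).le (hc0 _).le) (sq_nonneg _)) (fun k => ?_)
        (hB.mul_left β)
      have h1 : Γ k ≤ Λ / Θ k := by rw [le_div_iff₀ (hΘ k)]; exact hΓΘ k
      have h2 := (hc0 k).le
      have h3 := hΘ k
      calc Γ k * c k * σ k ^ 2 ≤ Λ / Θ k * c k * σ k ^ 2 := by gcongr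
        _ = β * (Λ / β * (c k * (σ k ^ 2 / Θ k))) := by field_simp)
    (fun k hk ω => by
      have h1 := (hK _ _ _ _ (hsch ω) w k (by omega) (hw k ω)).2
      have h2 : 0 ≤ β * (1 - 3 * μ / 2) * tPar μ r k * ‖F (x k ω) + ξ k ω‖ ^ 2 := by
        have := (hp.tPar_pos k).le
        have : 0 ≤ 1 - 3 * μ / 2 := by linarith
        positivity
      rw [← hcs] at h1
      simp only [hΔ', hDh, Nat.add_sub_cancel, Nat.add_eq_zero_iff, one_ne_zero, and_false, if_false,
        hGdef]
      linarith)
    hVR.error_le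
    (fun k hk => by
      filter_upwards [hVR.delta_le k] with ω hω
      have h1 := mul_le_mul_right hω (ENNReal.ofReal (Γ k * c k))
      refine h1.trans ?_
      rw [← ENNReal.ofReal_mul (mul_nonneg (hΓ k).le (hc0 k).le)]
      apply ENNReal.ofReal_le_ofReal
      have h2 : Γ k * Θ k * O.meanSqDiff (x k ω) (x (k - 1) ω) ≤ Dh k ω :=
        le_trans (mul_le_mul_of_nonneg_right (hΓΘ k) (hE _ _)) (hDhE k (by omega) ω)
      have h3 := mul_le_mul_of_nonneg_left h2 (hc0 k).le
      simp only [hΔ']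
      linarith)
  filter_upwards [hsum] with ω hω
  refine Summable.of_nonneg_of_le (fun k => by positivity) (fun k => ?_)
    (hω.mul_left ((1 + 2 * μ) / (2 * β)))
  have ht := hp.one_lt_tPar k
  -- `t²` and `t(t - 1)` are comparable because `t ≥ 1 + 2μ`; the constant is the value of `t/(t -
  -- 1)` at that bound.
  have h1 : tPar μ r k ^ 2 ≤ (1 + 2 * μ) / (2 * μ) * c (k + 1) := by
    rw [hcs, div_mul_eq_mul_div, le_div_iff₀ (by positivity)]
    nlinarith [mul_nonneg (hp.tPar_pos k).le (sub_nonneg.2 ht)]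
  calc tPar μ r k ^ 2 * ‖Ft k ω - F (x k ω)‖ ^ 2
      ≤ (1 + 2 * μ) / (2 * μ) * c (k + 1) * ‖Ft k ω - F (x k ω)‖ ^ 2 := by gcongr
    _ = _ := by field_simp

end Errors

/-! ### From weights `t_k` to powers of `k`. -/

section Limits

lemma natCast_add_one_le_tPar {μ r : ℝ} (hμ : 0 < μ) (hr : 2 + 1 / μ ≤ r) (k : ℕ) :
    (k : ℝ) + 1 ≤ 1 / μ * tPar μ r k := by
  rw [one_div_mul_eq_div, le_div_iff₀ hμ]
  have := one_add_le_tPar hμ hr k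
  linarith

lemma summable_natCast_mul_of_tPar {μ r : ℝ} (hμ : 0 < μ) (hr : 2 + 1 / μ ≤ r) {f : ℕ → ℝ}
    (hf : ∀ k, 0 ≤ f k) (h : Summable fun k : ℕ => tPar μ r k * f k) :
    Summable fun k : ℕ => ((k : ℝ) + 1) * f k := by
  refine Summable.of_nonneg_of_le (fun k => mul_nonneg (by positivity) (hf k)) (fun k => ?_)
    (h.mul_left (1 / μ))
  rw [← mul_assoc]
  exact mul_le_mul_of_nonneg_right (natCast_add_one_le_tPar hμ hr k) (hf k)

lemma summable_natCast_sq_mul_of_tPar {μ r : ℝ} (hμ : 0 < μ) (hr : 2 + 1 / μ ≤ r) {f : ℕ → ℝ}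
    (hf : ∀ k, 0 ≤ f k) (h : Summable fun k : ℕ => tPar μ r k ^ 2 * f k) :
    Summable fun k : ℕ => ((k : ℝ) + 1) ^ 2 * f k := by
  refine Summable.of_nonneg_of_le (fun k => mul_nonneg (by positivity) (hf k)) (fun k => ?_)
    (h.mul_left ((1 / μ) ^ 2))
  rw [← mul_assoc, ← mul_pow]
  exact mul_le_mul_of_nonneg_right
    (pow_le_pow_left₀ (by positivity) (natCast_add_one_le_tPar hμ hr k) 2) (hf k)

lemma tendsto_natCast_sq_mul_of_tPar {μ r : ℝ} (hμ : 0 < μ) (hr : 2 + 1 / μ ≤ r) {f : ℕ → ℝ}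
    (hf : ∀ k, 0 ≤ f k) (h : Tendsto (fun k : ℕ => tPar μ r k * f k) atTop (𝓝 0)) :
    Tendsto (fun k : ℕ => (k : ℝ) ^ 2 * f k ^ 2) atTop (𝓝 0) := by
  have h1 : Tendsto (fun k : ℕ => (1 / μ * (tPar μ r k * f k)) ^ 2) atTop (𝓝 0) := by
    simpa using (h.const_mul (1 / μ)).pow 2
  refine squeeze_zero (fun k => by positivity) (fun k => ?_) h1
  rw [← mul_pow, ← mul_assoc]
  refine pow_le_pow_left₀ (mul_nonneg (by positivity) (hf k)) ?_ 2
  refine mul_le_mul_of_nonneg_right ?_ (hf k)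
  linarith [natCast_add_one_le_tPar hμ hr k]

end Limits

/-! ### Assembly of the almost sure conclusions. -/

theorem mainTheorem6 {p : ℕ}
    {Ω : Type*} {mΩ : MeasurableSpace Ω} (Pr : Measure Ω) [IsProbabilityMeasure Pr]
    (ℱ : Filtration ℕ mΩ)
    -- the generalized equation
    (O : Oracle.{w} p) (F : Vec p → Vec p) (T : Vec p → Set (Vec p)) (L ρ : ℝ)
    (hO : O.Represents F)
    (hzer : (zer (sumOp F T)).Nonempty)
    (hvar : O.BoundedVariance F)
    (hρ : 0 ≤ ρ) (hT : MaximallyCoHypomonotone ρ T)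
    (hL : 0 < L) (hF : O.Cocoercive F L) (hLρ : L * ρ < 1)
    -- the parameters
    (Lhat lam μ r ν β : ℝ)
    (hLhat : L < Lhat) (hLhatρ : Lhat * ρ < 1)
    (hlam_pos : 0 < lam) (hlam_ge : 2 * ρ ≤ lam)
    (hlam_lt : lam < 2 * (1 + √(1 - Lhat * ρ)) / Lhat)
    (hμ_pos : 0 < μ) (hμ_lt : μ < 2 / 3) (hr : 2 + 1 / μ ≤ r) (hν : ν = μ / 2)
    (hβ_pos : 0 < β) (hβ_lt : β < (2 - μ) * betaBar lam Lhat ρ / (2 + μ))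
    -- the algorithm and its estimators
    (x u s v ξ Ft : ℕ → Ω → Vec p) (Δ : ℕ → Ω → ℝ) (κ Θ σ Γ : ℕ → ℝ)
    (hu0 : Measurable[ℱ 0] (u 0))
    (halg : IsVFOSAMinus T lam ν (tPar μ r) (etaPar μ r ν β) x u s v ξ Ft)
    (hVR : VREstimator Pr ℱ O F x Ft Δ κ Θ σ)
    (hκ : ∀ k : ℕ, 1 - Γ k * (tPar μ r (k - 1) * (tPar μ r (k - 1) - 1))
        / (Γ (k + 1) * (tPar μ r k * (tPar μ r k - 1))) + 5 * β / (μ * Γ (k + 1)) ≤ κ (k + 1))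
    (Θlow Γlow : ℝ) (hΘlow : 0 < Θlow) (hΓlow : 0 < Γlow)
    (hΓ : ∀ k, Γlow ≤ Γ k) (hΘ : ∀ k, Θlow ≤ Θ k)
    (hΓΘ : ∀ k, Γ k * Θ k ≤ lambdaConst L Lhat)
    (hB : Summable fun k : ℕ => lambdaConst L Lhat / β
        * (tPar μ r (k - 1) * (tPar μ r (k - 1) - 1) * (σ k ^ 2 / Θ k))) :
    (∀ k ω, ξ k ω ∈ T (x k ω)) ∧
    (∀ᵐ ω ∂Pr, Summable fun k : ℕ => ((k : ℝ) + 1) * ‖F (x k ω) + ξ k ω‖ ^ 2) ∧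
    (∀ᵐ ω ∂Pr, Summable fun k : ℕ => ((k : ℝ) + 1) ^ 2 * ‖Ft k ω - F (x k ω)‖ ^ 2) ∧
    (∀ᵐ ω ∂Pr, Summable fun k : ℕ => ((k : ℝ) + 1) * ‖u (k + 1) ω - u k ω‖ ^ 2) ∧
    (∀ᵐ ω ∂Pr, Summable fun k : ℕ => ((k : ℝ) + 1) * ‖x (k + 1) ω - x k ω‖ ^ 2) ∧
    (∀ᵐ ω ∂Pr, Tendsto (fun k : ℕ => (k : ℝ) ^ 2 * ‖x (k + 1) ω - x k ω‖ ^ 2) atTop (𝓝 0)) ∧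
    (∀ᵐ ω ∂Pr, Tendsto (fun k : ℕ => (k : ℝ) ^ 2 * ‖F (x k ω) + ξ k ω‖ ^ 2) atTop (𝓝 0)) ∧
    ∃ ustar xstar : Ω → Vec p, Measurable ustar ∧ Measurable xstar ∧
      (∀ ω, ustar ω ∈ zer (bfsResidual F T lam)) ∧
      (∀ ω, resolventOp lam T (ustar ω) = {xstar ω}) ∧
      (∀ ω, xstar ω ∈ zer (sumOp F T)) ∧
      (∀ᵐ ω ∂Pr, Tendsto (fun k => u k ω) atTop (𝓝 (ustar ω))) ∧
      (∀ᵐ ω ∂Pr, Tendsto (fun k => x k ω) atTop (𝓝 (xstar ω))) := by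
  subst hν
  have hp : AccelParams β (betaBar lam Lhat ρ) μ r := ⟨hμ_pos, hμ_lt, hβ_pos, hβ_lt, hr⟩
  have hE2 := Oracle.norm_sq_le_meanSqDiff hO hvar
  have hE : ∀ y z, 0 ≤ O.meanSqDiff y z := fun y z => (sq_nonneg _).trans (hE2 y z)
  have hFc : Continuous F := (lipschitz_of_cocoercive hL hF hE2).continuous
  have hΛ : 0 ≤ lambdaConst L Lhat := div_nonneg (by linarith) (by nlinarith)
  have hxi := fun k ω => halg.xi_mem_and_u_eq hlam_pos k ω
  have hco : ∀ j k ω, lambdaConst L Lhat * O.meanSqDiff (x j ω) (x k ω)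
      + betaBar lam Lhat ρ * ‖(F (x j ω) + ξ j ω) - (F (x k ω) + ξ k ω)‖ ^ 2
      ≤ ⟪(F (x j ω) + ξ j ω) - (F (x k ω) + ξ k ω), u j ω - u k ω⟫ := fun j k ω => by
    rw [(hxi j ω).2, (hxi k ω).2]
    exact residual_cocoercive hT.1 hL hLhat hLhatρ hF hE2 (hxi j ω).1 (hxi k ω).1
  have hsch := fun ω => halg.accelScheme (F := F) hp ω fun k =>
    le_trans (le_add_of_nonneg_left (mul_nonneg hΛ (hE _ _))) (hco (k + 1) k ω)
  have hnn : ∀ q ∈ zeroPairs F T lam, ∀ k ω, 0 ≤ ⟪F (x k ω) + ξ k ω, u k ω - q.1⟫ :=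
    fun q hq k ω => by
      rw [(hxi k ω).2]
      exact residual_inner_nonneg hT.1 hL hLhat hLhatρ hF hE2 hp.betaBar_pos.le (hxi k ω).1 hq
  have hnex : ∀ j k ω, ‖x j ω - x k ω‖ ≤ ‖u j ω - u k ω‖ := fun j k ω => by
    rw [(hxi j ω).2, (hxi k ω).2]
    exact hT.1.norm_sub_le hlam_pos hlam_ge (hxi j ω).1 (hxi k ω).1
  have hmeas := fun k =>
    halg.measurable hu0 hVR.measurable_iterate hVR.measurable_estimator k
  obtain ⟨q₀, hq₀⟩ := zeroPairs_nonempty (lam := lam) hzer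
  have herr := hVR.ae_summable_error hFc hp (fun k => (hmeas k).1) (fun k => (hmeas k).2.1)
    (fun k => (hmeas k).2.2) hE (fun k ω => hco (k + 1) k ω) hsch (hnn q₀ hq₀) hκ
    (fun k => hΓlow.trans_le (hΓ k)) (fun k => hΘlow.trans_le (hΘ k)) hΛ hΓΘ hB
  have hconv : ∀ᵐ ω ∂Pr,
      (Summable fun k : ℕ => tPar μ r k * ‖F (x k ω) + ξ k ω‖ ^ 2) ∧
      (Summable fun k : ℕ => tPar μ r k * ‖u (k + 1) ω - u k ω‖ ^ 2) ∧
      Tendsto (fun k : ℕ => tPar μ r k * ‖F (x k ω) + ξ k ω‖) atTop (𝓝 0) ∧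
      Tendsto (fun k : ℕ => tPar μ r k * ‖u (k + 1) ω - u k ω‖) atTop (𝓝 0) ∧
      ∀ w : Vec p, (∀ k, 0 ≤ ⟪F (x k ω) + ξ k ω, u k ω - w⟫) →
        ∃ l, Tendsto (fun k => ‖u k ω - w‖) atTop (𝓝 l) := by
    filter_upwards [herr] with ω hω
    exact AccelScheme.convergence (G := fun k => F (x k ω) + ξ k ω)
      (e := fun k => Ft k ω - F (x k ω)) (u := fun k => u k ω) (s := fun k => s k ω) hp (hsch ω) hω
      (w₀ := q₀.1) fun k => hnn q₀ hq₀ k ω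
  have hlim : ∀ᵐ ω ∂Pr, ∃ q ∈ zeroPairs F T lam,
      Tendsto (fun k => (u k ω, x k ω)) atTop (𝓝 q) := by
    filter_upwards [hconv] with ω ⟨_, _, h3, _, h5⟩
    have hG0 : Tendsto (fun k => F (x k ω) + ξ k ω) atTop (𝓝 0) := by
      refine squeeze_zero_norm (fun k => ?_) h3
      have := hp.one_lt_tPar k
      exact le_mul_of_one_le_left (norm_nonneg _) (by linarith)
    obtain ⟨a, ⟨q, hq, rfl⟩, ha⟩ := exists_tendsto_of_quasi_fejer
      (Z := Prod.fst '' zeroPairs F T lam) (u := fun k => u k ω) ⟨_, q₀, hq₀, rfl⟩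
      (by rintro _ ⟨q, hq, rfl⟩; exact h5 q.1 fun k => hnn q hq k ω)
      (fun φ a hφ ha => zeroPairs_of_tendsto hT hFc hlam_pos hlam_ge (fun k => (hxi k ω).1)
        (fun k => (hxi k ω).2) hG0 hφ ha)
    refine ⟨q, hq, ha.prodMk_nhds ?_⟩
    rw [tendsto_iff_norm_sub_tendsto_zero] at ha ⊢
    obtain ⟨v', hv', hqu, -⟩ := hq
    refine squeeze_zero (fun k => norm_nonneg _) (fun k => ?_) ha
    rw [hqu, (hxi k ω).2]
    exact hT.1.norm_sub_le hlam_pos hlam_ge (hxi k ω).1 hv'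
  refine ⟨fun k ω => (hxi k ω).1, ?_, ?_, ?_, ?_, ?_, ?_, ?_⟩
  · filter_upwards [hconv] with ω h
    exact summable_natCast_mul_of_tPar hμ_pos hr (fun k => sq_nonneg _) h.1
  · filter_upwards [herr] with ω h
    exact summable_natCast_sq_mul_of_tPar hμ_pos hr (fun k => sq_nonneg _) h
  · filter_upwards [hconv] with ω h
    exact summable_natCast_mul_of_tPar hμ_pos hr (fun k => sq_nonneg _) h.2.1
  · filter_upwards [hconv] with ω h
    refine Summable.of_nonneg_of_le (fun k => by positivity) (fun k => ?_)
      (summable_natCast_mul_of_tPar hμ_pos hr (fun k => sq_nonneg _) h.2.1)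
    gcongr
    exact hnex _ _ _
  · filter_upwards [hconv] with ω h
    refine squeeze_zero (fun k => by positivity) (fun k => ?_)
      (tendsto_natCast_sq_mul_of_tPar hμ_pos hr (fun k => norm_nonneg _) h.2.2.2.1)
    gcongr
    exact hnex _ _ _
  · filter_upwards [hconv] with ω h
    exact tendsto_natCast_sq_mul_of_tPar hμ_pos hr (fun k => norm_nonneg _) h.2.2.1
  -- Taking the limit of the pair `(u, x)` makes both limits measurable at once, without any
  -- measurability of the resolvent.
  · obtain ⟨f, hfm, hf⟩ := measurable_limit_of_tendsto_metrizable_ae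
      (μ := Pr) (L := atTop) (f := fun k ω => (u k ω, x k ω))
      (fun k => ((((hmeas k).1.mono (ℱ.le k) le_rfl).prodMk
        ((hVR.measurable_iterate k).mono (ℱ.le k) le_rfl))).aemeasurable)
      (by filter_upwards [hlim] with ω ⟨q, _, hq⟩; exact ⟨q, hq⟩)
    have hfZ : ∀ᵐ ω ∂Pr, f ω ∈ zeroPairs F T lam := by
      filter_upwards [hlim, hf] with ω ⟨q, hqZ, hq⟩ hfω
      rwa [tendsto_nhds_unique hfω hq]
    -- A change on a null set makes the limit a zero pair at every `ω`, as the pointwise claims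
    -- about its values require.
    obtain ⟨g, hgm, hgZ, hfg⟩ := hfm.aemeasurable.exists_ae_eq_range_subset hfZ ⟨q₀, hq₀⟩
    have hgZ' : ∀ ω, g ω ∈ zeroPairs F T lam := fun ω => hgZ ⟨ω, rfl⟩
    have hg : ∀ᵐ ω ∂Pr, Tendsto (fun k => (u k ω, x k ω)) atTop (𝓝 (g ω)) := by
      filter_upwards [hf, hfg] with ω h1 h2
      rwa [← h2]
    refine ⟨fun ω => (g ω).1, fun ω => (g ω).2, hgm.fst, hgm.snd, fun ω => ?_, fun ω => ?_,
      fun ω => ?_, ?_, ?_⟩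
    · obtain ⟨w, hw, h1, h2⟩ := hgZ' ω
      refine ⟨(g ω).2, ⟨w, hw, h1⟩, ?_⟩
      change 0 = F (g ω).2 + lam⁻¹ • ((g ω).1 - (g ω).2)
      rw [h1, add_sub_cancel_left, inv_smul_smul₀ hlam_pos.ne', h2]
    · obtain ⟨w, hw, h1, h2⟩ := hgZ' ω
      refine Set.eq_singleton_iff_unique_mem.2 ⟨⟨w, hw, h1⟩, fun y ⟨w', hw', h'⟩ => ?_⟩
      have := hT.1.norm_sub_le hlam_pos hlam_ge hw' hw
      rw [← h', ← h1, sub_self, norm_zero] at this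
      exact sub_eq_zero.1 (norm_le_zero_iff.1 this)
    · obtain ⟨w, hw, h1, h2⟩ := hgZ' ω
      exact ⟨w, hw, h2.symm⟩
    · filter_upwards [hg] with ω h
      exact (continuous_fst.tendsto _).comp h
    · filter_upwards [hg] with ω h
      exact (continuous_snd.tendsto _).comp h
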